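/- **Setting.** A binary memoryless symmetric (BMS) channel $W$ has input alphabet $\{0,1\}$, an arbitrary output alphabet with transition densities $W(y\mid x)$ with respect to a reference measure (sums below are integrals for continuous outputs), and an involution $\pi$ of the output alphabet, preserving the reference measure, with $W(\pi(y)\mid x)=W(y\mid x\oplus1)$. Its capacity is $I(W)=\sum_{x,y}\frac12W(y|x)\log_2\frac{W(y|x)}{\frac12W(y|0)+\frac12W(y|1)}$. The polarized channels are $W^-(y_1,y_2|u_1)=\sum_{u_2}\frac12W(y_1|u_1\oplus u_2)W(y_2|u_2)$ and $W^+(y_1,y_2,u_1|u_2)=\frac12W(y_1|u_1\oplus u_2)W(y_2|u_2)$. **Exponents.** For $0\le R\le 1$ (bits per channel use) let $E(W,R)=\max[E_r(W,R),E_{ex}(W,R)]$, where $E_r(W,0)=\infty$ and, for $R\ne0$, $$E_r(W,R)=\max_{0\le\rho\le1}\Big\{-\ln\sum_y\Big(\tfrac12\big[W(y|0)^{\frac1{1+\rho}}+W(y|1)^{\frac1{1+\rho}}\big]\Big)^{1+\rho}-\rho R\ln2\Big\},$$ $$E_{ex}(W,R)=\sup_{\rho\ge1}\Big\{-\rho\ln\frac{1+Z(W)^{1/\rho}}{2}-\rho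 R\ln 2\Big\},\qquad Z(W)=\sum_y\sqrt{W(y|0)W(y|1)} .$$ Let $\mathcal B=[\max(0,2R-1),\min(1,2R)]$, $E_0(W,R)=E(W,R)$ and, for $\lambda\ge1$, $$E_\lambda(W,R)=\tfrac12\max_{R_1\in\mathcal B}\min\big[E_{\lambda-1}(W^-,R_1),\,E_{\lambda-1}(W^+,2R-R_1)\big].$$ **The capacity-only bound.** Let $h_2$ be the binary entropy function in bits, $h_2^{-1}$ its inverse with values in $[0,\frac12]$, $\epsilon_h(x)=x-x^2$ and $\epsilon_l(x)=x-1+h_2\big(h_2^{-1}(1-x)[2-2h_2^{-1}(1-x)]\big)$. Let $\hat E_0(I,R)=E_{BSC}(I,R)$ be the exponent $E$ of the binary symmetric channel of capacity $I$ and, for $\lambda\ge1$, $$\hat E_\lambda(I,R)=\tfrac12\min_{\epsilon\in[\epsilon_l(I),\epsilon_h(I)]}\ \max_{R_1\in\mathcal B}\ \min\big[\hat E_{\lambda-1}(I-\epsilon,R_1),\,\hat E_{\lambda-1}(I+\epsilon,2R-R_1)\big].$$ (Maxima and minima are understood as suprema and infima in $[-\infty,\infty]$.) **The scheme.** In the concatenated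 scheme with $\lambda$ polarization steps, $2^\lambda$ linear outer codes of blocklength $N_1$ with independent, uniformly random generator matrices, of dimensions $k_i\le N_1$, encode $2^\lambda$ messages; the codewords are interleaved and encoded by $N_1$ polar transforms of length $2^\lambda$, and the total blocklength is $N=2^\lambda N_1$. The decoder decodes the outer codes one after the other by maximum likelihood, each over its own sub-channel of $W$, feeding the decided codewords back. A real $e$ is an achievable error exponent at rate $R$ if there are rate splits $(k_i)$ depending on $N_1$, with $\sum_i k_i\ge RN$, such that with probability tending to $1$ as $N_1\to\infty$ over the choice of the outer codes, the block error probability is at most $e^{-Ne}$. **Theorem.** For every BMS channel $W$, every rate $R\in[0,1]$ and every $\lambda\ge0$, $$\hat E_\lambda(I(W),R)\ \le\ E_\lambda(W,R),$$ and $E_\lambda(W,R)$ is at most the supremum of the achievable error exponents at rate $R$ of the concatenated scheme with $\lambda$ polarization steps. In particular the best achievable error exponent is at least $\hat E_\lambda(I(W),R)$, which depends on $W$ only through its capacity. -/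

import Mathlib

open MeasureTheory Set Filter Topology
open scoped NNReal ENNReal Matrix

universe u

noncomputable section

/-! ### Binary memoryless symmetric channels -/

/-- A binary-input memoryless symmetric (BMS) channel with an arbitrary (discrete, continuous or
mixed) output alphabet `Y`. `w x y` is the transition density `W(y | x)` with respect to the
reference measure `μ` (counting measure for a discrete channel, Lebesgue measure for the
binary-input Gaussian channel, ...). Symmetry: there is an involution `π` of the output alphabet
with `W(π(y) | x) = W(y | x ⊕ 1)`. -/
structure BMS : Type (u + 1) where
  Y : Type u
  [measurableSpace : MeasurableSpace Y]
  μ : Measure Y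
  [sigmaFinite : SigmaFinite μ]
  w : ZMod 2 → Y → ℝ≥0
  measurable_w : ∀ x, Measurable (w x)
  lintegral_w : ∀ x, ∫⁻ y, (w x y : ℝ≥0∞) ∂μ = 1
  symmetric : ∃ π : Y → Y, MeasurePreserving π μ μ ∧ Function.Involutive π ∧
    ∀ x y, w x (π y) = w (x + 1) y

attribute [instance] BMS.measurableSpace BMS.sigmaFinite

namespace BMS

/-- The law of the channel output when the input bit is `x`. -/
def law (W : BMS.{u}) (x : ZMod 2) : Measure W.Y := W.μ.withDensity fun y => (W.w x y : ℝ≥0∞)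

/-- The capacity of `W`, in bits per channel use. -/
def capacity (W : BMS.{u}) : ℝ :=
  ∑ x : ZMod 2, ∫ y, (1 / 2 : ℝ) * (W.w x y : ℝ) *
    Real.logb 2 ((W.w x y : ℝ) / ∑ x' : ZMod 2, (1 / 2 : ℝ) * (W.w x' y : ℝ)) ∂W.μ

/-- The polarized channel `W⁻ : u₁ ↦ (y₁, y₂)`,
`W⁻(y₁, y₂ | u₁) = ∑_{u₂} (1/2) W(y₁ | u₁ ⊕ u₂) W(y₂ | u₂)`. -/
def minus (W : BMS.{u}) : BMS.{u} where
  Y := W.Y × W.Y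
  μ := W.μ.prod W.μ
  w u₁ y := ∑ u₂ : ZMod 2, (1 / 2) * (W.w (u₁ + u₂) y.1 * W.w u₂ y.2)
  measurable_w u₁ := by
    refine Finset.measurable_sum _ fun u₂ _ => ?_
    exact (((W.measurable_w _).comp measurable_fst).mul
      ((W.measurable_w _).comp measurable_snd)).const_mul _
  lintegral_w u₁ := by
    have h : ∀ a b : ZMod 2, ∫⁻ y : W.Y × W.Y, (W.w a y.1 : ℝ≥0∞) * (W.w b y.2 : ℝ≥0∞)
        ∂(W.μ.prod W.μ) = 1 := fun a b => by
      rw [lintegral_prod_mul (W.measurable_w a).coe_nnreal_ennreal.aemeasurable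
        (W.measurable_w b).coe_nnreal_ennreal.aemeasurable, W.lintegral_w, W.lintegral_w, one_mul]
    have hm : ∀ a b : ZMod 2, Measurable fun y : W.Y × W.Y =>
        (W.w a y.1 : ℝ≥0∞) * (W.w b y.2 : ℝ≥0∞) := fun a b =>
      ((W.measurable_w a).coe_nnreal_ennreal.comp measurable_fst).mul
        ((W.measurable_w b).coe_nnreal_ennreal.comp measurable_snd)
    push_cast
    rw [lintegral_finsetSum _ fun b _ => (hm _ b).const_mul _]
    simp_rw [lintegral_const_mul _ (hm _ _), h]
    simp [Finset.sum_const, ZMod.card, ENNReal.mul_inv_cancel]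
  symmetric := by
    obtain ⟨π, hπ, hi, hs⟩ := W.symmetric
    refine ⟨Prod.map π id, hπ.prod (MeasurePreserving.id _), fun y => Prod.ext (hi y.1) rfl,
      fun u₁ y => ?_⟩
    · simp only [Prod.map_fst, Prod.map_snd, id, hs]
      simp only [add_right_comm]

/-- The polarized channel `W⁺ : u₂ ↦ (y₁, y₂, u₁)`,
`W⁺(y₁, y₂, u₁ | u₂) = (1/2) W(y₁ | u₁ ⊕ u₂) W(y₂ | u₂)`. -/
def plus (W : BMS.{u}) : BMS.{u} where
  Y := (W.Y × W.Y) × ZMod 2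
  μ := (W.μ.prod W.μ).prod Measure.count
  w u₂ y := (1 / 2) * (W.w (y.2 + u₂) y.1.1 * W.w u₂ y.1.2)
  measurable_w u₂ := by
    refine measurable_from_prod_countable_left fun u₁ => ?_
    exact (((W.measurable_w _).comp measurable_fst).mul
      ((W.measurable_w _).comp measurable_snd)).const_mul _
  lintegral_w u₂ := by
    have h : ∀ a b : ZMod 2, ∫⁻ y : W.Y × W.Y, (W.w a y.1 : ℝ≥0∞) * (W.w b y.2 : ℝ≥0∞)
        ∂(W.μ.prod W.μ) = 1 := fun a b => by
      rw [lintegral_prod_mul (W.measurable_w a).coe_nnreal_ennreal.aemeasurable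
        (W.measurable_w b).coe_nnreal_ennreal.aemeasurable, W.lintegral_w, W.lintegral_w, one_mul]
    have hm : ∀ a b : ZMod 2, Measurable fun y : W.Y × W.Y =>
        (W.w a y.1 : ℝ≥0∞) * (W.w b y.2 : ℝ≥0∞) := fun a b =>
      ((W.measurable_w a).coe_nnreal_ennreal.comp measurable_fst).mul
        ((W.measurable_w b).coe_nnreal_ennreal.comp measurable_snd)
    have hM : Measurable fun y : (W.Y × W.Y) × ZMod 2 =>
        (((1 / 2) * (W.w (y.2 + u₂) y.1.1 * W.w u₂ y.1.2) : ℝ≥0) : ℝ≥0∞) := by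
      refine Measurable.coe_nnreal_ennreal (measurable_from_prod_countable_left fun u₁ => ?_)
      exact (((W.measurable_w _).comp measurable_fst).mul
        ((W.measurable_w _).comp measurable_snd)).const_mul _
    rw [lintegral_prod_symm' _ hM, lintegral_count, tsum_fintype]
    push_cast
    simp_rw [lintegral_const_mul _ (hm _ _), h]
    simp [Finset.sum_const, ZMod.card, ENNReal.mul_inv_cancel]
  symmetric := by
    obtain ⟨π, hπ, hi, hs⟩ := W.symmetric
    refine ⟨Prod.map (Prod.map π π) id, (hπ.prod hπ).prod (MeasurePreserving.id _),
      fun y => Prod.ext (Prod.ext (hi y.1.1) (hi y.1.2)) rfl, fun u₂ y => ?_⟩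
    · simp only [Prod.map_fst, Prod.map_snd, id, hs, add_assoc]

/-- The binary symmetric channel with crossover probability `p`. -/
def bsc (p : ℝ) (hp : p ∈ Icc (0 : ℝ) 1) : BMS.{0} where
  Y := ZMod 2
  μ := Measure.count
  w x y := if y = x then ⟨1 - p, sub_nonneg.2 hp.2⟩ else ⟨p, hp.1⟩
  measurable_w x := measurable_of_countable _
  lintegral_w x := by
    have h : (⟨1 - p, sub_nonneg.2 hp.2⟩ : ℝ≥0) + ⟨p, hp.1⟩ = 1 := by
      ext; simp
    have h' : (⟨p, hp.1⟩ : ℝ≥0) + ⟨1 - p, sub_nonneg.2 hp.2⟩ = 1 := by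
      rw [add_comm]; exact h
    rw [lintegral_count, tsum_fintype, ← ENNReal.ofNNReal_finsetSum, ← ENNReal.coe_one,
      ENNReal.coe_inj]
    fin_cases x
    · exact (Fin.sum_univ_two _).trans h
    · exact (Fin.sum_univ_two _).trans h'
  symmetric := by
    refine ⟨fun y => y + 1, ?_, fun y => ?_, fun x y => ?_⟩
    · refine ⟨measurable_of_countable _, ?_⟩
      ext s hs
      rw [Measure.map_apply (measurable_of_countable _) hs, Measure.count_apply
        (measurable_of_countable (fun y : ZMod 2 => y + 1) hs), Measure.count_apply hs]
      exact congrArg _ (encard_preimage_of_bijective (Equiv.addRight (1 : ZMod 2)).bijective s)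
    · revert y; decide
    · have : (y + 1 = x) ↔ (y = x + 1) := by revert x y; decide
      simp only [this]

/-! ### Random-coding and expurgated exponents of a single channel -/

/-- Gallager's function
`E₀(W, ρ) = -ln ∫ ( ½ [W(y|0)^{1/(1+ρ)} + W(y|1)^{1/(1+ρ)}] )^{1+ρ} dy`. -/
def gallagerE0 (W : BMS.{u}) (ρ : ℝ) : ℝ :=
  -Real.log (∫ y, ((1 / 2 : ℝ) * ((W.w 0 y : ℝ) ^ (1 / (1 + ρ)) + (W.w 1 y : ℝ) ^ (1 / (1 + ρ))))
    ^ (1 + ρ) ∂W.μ)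

/-- The Bhattacharyya parameter `∫ √(W(y|0) W(y|1)) dy`. -/
def bhattacharyya (W : BMS.{u}) : ℝ := ∫ y, Real.sqrt ((W.w 0 y : ℝ) * (W.w 1 y : ℝ)) ∂W.μ

/-- Gallager's expurgated function `E_x(W, ρ) = -ρ ln ([1 + Z^{1/ρ}] / 2)`. -/
def gallagerEx (W : BMS.{u}) (ρ : ℝ) : ℝ :=
  -ρ * Real.log ((1 + W.bhattacharyya ^ (1 / ρ)) / 2)

/-- The random-coding exponent at rate `R` (in bits per channel use), equal to `∞` at `R = 0`. -/
def Er (W : BMS.{u}) (R : ℝ) : EReal :=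
  if R = 0 then ⊤
  else ⨆ ρ ∈ Icc (0 : ℝ) 1, ((W.gallagerE0 ρ - ρ * R * Real.log 2 : ℝ) : EReal)

/-- The expurgated exponent at rate `R` (in bits per channel use). -/
def Eex (W : BMS.{u}) (R : ℝ) : EReal :=
  ⨆ ρ ∈ Ici (1 : ℝ), ((W.gallagerEx ρ - ρ * R * Real.log 2 : ℝ) : EReal)

/-- `E(W, R) = max [E_r(W, R), E_ex(W, R)]`. -/
def E (W : BMS.{u}) (R : ℝ) : EReal := max (W.Er R) (W.Eex R)

end BMS

/-- The set `B = [max(0, 2R - 1), min(1, 2R)]` of admissible first rates in a rate split. -/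
def rateInterval (R : ℝ) : Set ℝ := Icc (max 0 (2 * R - 1)) (min 1 (2 * R))

namespace BMS

/-- The exponent `E_l(W, R)` of the concatenated scheme with `l` polarization steps:
`E_0 = E` and
`E_{l+1}(W, R) = ½ max_{R₁ ∈ B} min [E_l(W⁻, R₁), E_l(W⁺, 2R - R₁)]`. -/
def polarExponent : ℕ → BMS.{u} → ℝ → EReal
  | 0, W, R => W.E R
  | l + 1, W, R => ((1 / 2 : ℝ) : EReal) * ⨆ R₁ ∈ rateInterval R,
      min (polarExponent l W.minus R₁) (polarExponent l W.plus (2 * R - R₁))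

end BMS

/-! ### The bound that depends on the capacity only -/

/-- The binary entropy function, in bits. -/
def h₂ (p : ℝ) : ℝ := Real.binEntropy p / Real.log 2

/-- The inverse of `h₂` on `[0, 1]`, with values in `[0, 1/2]`. -/
def h₂Inv (y : ℝ) : ℝ := sSup {p ∈ Icc (0 : ℝ) (1 / 2) | h₂ p ≤ y}

theorem h₂Inv_mem (y : ℝ) : h₂Inv y ∈ Icc (0 : ℝ) (1 / 2) :=
  ⟨Real.sSup_nonneg fun _ hp => hp.1.1, Real.sSup_le (fun _ hp => hp.1.2) (by norm_num)⟩

theorem h₂Inv_mem_unit (y : ℝ) : h₂Inv y ∈ Icc (0 : ℝ) 1 :=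
  ⟨(h₂Inv_mem y).1, (h₂Inv_mem y).2.trans (by norm_num)⟩

/-- `h₂Inv` is indeed the inverse of `h₂` on `[0, 1/2]`. -/
theorem h₂Inv_h₂ {p : ℝ} (hp : p ∈ Icc (0 : ℝ) (1 / 2)) : h₂Inv (h₂ p) = p := by
  have hl : 0 < Real.log 2 := Real.log_pos (by norm_num)
  refine le_antisymm (Real.sSup_le (fun q hq => ?_) hp.1) (le_csSup ⟨1 / 2, fun q hq => hq.1.2⟩
    ⟨hp, le_rfl⟩)
  have h := (div_le_div_iff_of_pos_right hl).1 hq.2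
  exact (Real.binEntropy_strictMonoOn.le_iff_le (by simpa using hq.1) (by simpa using hp)).1 h

/-- `ε_l(x) = x - 1 + h₂( h₂⁻¹(1 - x) [2 - 2 h₂⁻¹(1 - x)] )`. -/
def gapLow (x : ℝ) : ℝ := x - 1 + h₂ (h₂Inv (1 - x) * (2 - 2 * h₂Inv (1 - x)))

/-- `ε_h(x) = x - x²`. -/
def gapHigh (x : ℝ) : ℝ := x - x ^ 2

/-- `E_BSC(I, R)`: the exponent `E` of the binary symmetric channel of capacity `I`. -/
def EBSC (I R : ℝ) : EReal := (BMS.bsc (h₂Inv (1 - I)) (h₂Inv_mem_unit (1 - I))).E R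

/-- The capacity-only bound: `Ê_0 = E_BSC` and
`Ê_{l+1}(I, R) = ½ min_{ε ∈ [ε_l(I), ε_h(I)]} max_{R₁ ∈ B}
  min [Ê_l(I - ε, R₁), Ê_l(I + ε, 2R - R₁)]`. -/
def capacityExponent : ℕ → ℝ → ℝ → EReal
  | 0, I, R => EBSC I R
  | l + 1, I, R => ((1 / 2 : ℝ) : EReal) * ⨅ ε ∈ Icc (gapLow I) (gapHigh I),
      ⨆ R₁ ∈ rateInterval R,
        min (capacityExponent l (I - ε) R₁) (capacityExponent l (I + ε) (2 * R - R₁))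

/-! ### The concatenated coding scheme -/

/-- The index set of the `2 ^ l` sub-channels (outer codes, inner code positions) after `l`
polarization steps. The left summand belongs to the first half `0, …, 2 ^ (l - 1) - 1`, that is,
to `W⁻`, and the right summand to the second half, that is, to `W⁺`. -/
def SubIdx : ℕ → Type
  | 0 => Unit
  | l + 1 => SubIdx l ⊕ SubIdx l

instance instFintypeSubIdx : (l : ℕ) → Fintype (SubIdx l)
  | 0 => inferInstanceAs (Fintype Unit)
  | l + 1 =>
    letI := instFintypeSubIdx l
    inferInstanceAs (Fintype (SubIdx l ⊕ SubIdx l))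

instance instDecidableEqSubIdx : (l : ℕ) → DecidableEq (SubIdx l)
  | 0 => inferInstanceAs (DecidableEq Unit)
  | l + 1 =>
    letI := instDecidableEqSubIdx l
    inferInstanceAs (DecidableEq (SubIdx l ⊕ SubIdx l))

theorem card_subIdx (l : ℕ) : Fintype.card (SubIdx l) = 2 ^ l := by
  induction l with
  | zero => rfl
  | succ l ih =>
    have h : Fintype.card (SubIdx (l + 1)) = Fintype.card (SubIdx l ⊕ SubIdx l) :=
      Fintype.card_congr (Equiv.refl _)
    rw [h, Fintype.card_sum, ih]; ring

/-- The inner polar encoder of length `2 ^ l`, built from `(u₁, u₂) ↦ (u₁ ⊕ u₂, u₂)`. With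
`A = Fin n → ZMod 2` it acts on `n` interleaved inner codewords at once. -/
def polarEncode {A : Type*} [Add A] : (l : ℕ) → (SubIdx l → A) → (SubIdx l → A)
  | 0, u => u
  | l + 1, u => Sum.elim
      (polarEncode l (fun s => u (Sum.inl s)) + polarEncode l (fun s => u (Sum.inr s)))
      (polarEncode l (fun s => u (Sum.inr s)))

/-- A family of outer linear codes of blocklength `n`: the code with index `s` has dimension `k s`
(rate `k s / n`) and is given by a generator matrix. -/
abbrev OuterCodes (l n : ℕ) (k : SubIdx l → ℕ) : Type :=
  ∀ s, Matrix (Fin (k s)) (Fin n) (ZMod 2)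

/-- One message for each outer code. -/
abbrev Messages (l : ℕ) (k : SubIdx l → ℕ) : Type := ∀ s, Fin (k s) → ZMod 2

/-- The codeword of the concatenated scheme: each message is encoded by its outer code, and the
resulting codewords are interleaved and encoded by `n` inner polar codes of length `2 ^ l`. -/
def concatEncode {l n : ℕ} {k : SubIdx l → ℕ} (G : OuterCodes l n k) (m : Messages l k) :
    SubIdx l → Fin n → ZMod 2 :=
  polarEncode l fun s => m s ᵥ* G s

/-- Maximum-likelihood decoding over `W` of the linear code with generator matrix `G` (ties are
resolved by a fixed enumeration of the messages; the list below is never empty). -/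
def mlDecode (W : BMS.{u}) {k n : ℕ} (G : Matrix (Fin k) (Fin n) (ZMod 2)) (y : Fin n → W.Y) :
    Fin k → ZMod 2 :=
  ((Finset.univ : Finset (Fin k → ZMod 2)).toList.argmax
    fun m => ∏ t, (W.w ((m ᵥ* G) t) (y t) : ℝ)).getD 0

/-- Successive (block) decoding: the outer codes are ML-decoded one after the other, each of them
over its own sub-channel, the decisions on the previous codewords being fed back. The first half is
decoded over `W⁻`; its re-encoded decisions become part of the output of `W⁺`, over which the second
half is decoded. -/
def scDecode : (l : ℕ) → (W : BMS.{u}) → {n : ℕ} → {k : SubIdx l → ℕ} → OuterCodes l n k →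
    (SubIdx l → Fin n → W.Y) → Messages l k
  | 0, W, _, _, G, y => fun s => mlDecode W (G s) (y s)
  | l + 1, W, n, k, G, y =>
    let m₁ : Messages l (fun s => k (Sum.inl s)) := scDecode l W.minus (fun s => G (Sum.inl s))
      fun s t => (y (Sum.inl s) t, y (Sum.inr s) t)
    let v : SubIdx l → Fin n → ZMod 2 := concatEncode (fun s => G (Sum.inl s)) m₁
    let m₂ : Messages l (fun s => k (Sum.inr s)) := scDecode l W.plus (fun s => G (Sum.inr s))
      fun s t => ((y (Sum.inl s) t, y (Sum.inr s) t), v s t)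
    fun s => Sum.rec (motive := fun s => Fin (k s) → ZMod 2) m₁ m₂ s

/-- The law of the channel output when the word `x` is sent over `W`, each symbol being transmitted
independently. -/
def outputLaw (W : BMS.{u}) {l n : ℕ} (x : SubIdx l → Fin n → ZMod 2) :
    Measure (SubIdx l → Fin n → W.Y) :=
  Measure.pi fun s => Measure.pi fun t => W.law (x s t)

/-- The block error probability of the concatenated scheme under successive decoding, for uniformly
distributed messages. -/
def errorProb (W : BMS.{u}) {l n : ℕ} {k : SubIdx l → ℕ} (G : OuterCodes l n k) : ℝ :=
  (∑ m : Messages l k, (outputLaw W (concatEncode G m)).real {y | scDecode l W G y ≠ m}) /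
    Fintype.card (Messages l k)

/-- The probability, when all the entries of all the generator matrices are independent and uniform
on `{0, 1}`, that the block error probability of the concatenated scheme is at most `δ`. -/
def probErrorLe (W : BMS.{u}) (l n : ℕ) (k : SubIdx l → ℕ) (δ : ℝ) : ℝ :=
  (Nat.card {G : OuterCodes l n k // errorProb W G ≤ δ} : ℝ) / Nat.card (OuterCodes l n k)

/-- `e` is an achievable error exponent at rate `R` with `l` polarization steps: for a suitable rate
split with total rate at least `R`, the block error probability of the scheme with random linear
outer codes of blocklength `n` is at most `exp (-N e)`, where `N = 2 ^ l * n` is the total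
blocklength, with probability tending to `1` as `n → ∞` (i.e. for typical outer codes). -/
def IsAchievableExponent (W : BMS.{u}) (l : ℕ) (R e : ℝ) : Prop :=
  ∃ k : ℕ → SubIdx l → ℕ,
    (∀ n s, k n s ≤ n) ∧
    (∀ n, R * (2 ^ l * n) ≤ ∑ s, (k n s : ℝ)) ∧
    Tendsto (fun n => probErrorLe W l n (k n) (Real.exp (-(2 ^ l * n) * e))) atTop (𝓝 1)

/-- The best achievable error exponent of the concatenated scheme. -/
def bestExponent (W : BMS.{u}) (l : ℕ) (R : ℝ) : EReal :=
  ⨆ e ∈ {e : ℝ | IsAchievableExponent W l R e}, (e : EReal)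

end

/-! Given its output, a BMS channel acts on a uniform input only through the posterior probability
`post`, so it is a mixture of binary symmetric channels. Its capacity fixes the mean binary entropy
of `post` (`log_two_mul_capacity`). If `f` is convex as a function of the entropy, Jensen's
inequality bounds the mean of `f (post)` from below by its value for the BSC of equal capacity, and
the chord bounds it from above by its value for an erasure-type mixture of the posteriors 0, 1 and
1/2.

This is applied twice. For minus the Gallager kernel (`entropyConvex_neg_gallagerKernel`) it shows
that the BSC has the smallest exponent `E` (`EBSC_le_E`). For the entropy of a bit after a cascade
with a BSC (`entropyConvex_cascade`, the convexity behind Mrs. Gerber's lemma) it confines the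
capacity of `W⁻`. The chain rule (`equivocation_minus_add_plus`) puts the capacities of `W⁻` and
`W⁺` symmetrically about that of `W`, so the true gap is one of the `ε` competing in the minimum
(`exists_gap`). Induction on the number of steps gives the first inequality.

For achievability, symmetry makes the law of the likelihoods at `W⁻` independent of the second
input, and at `W⁺` independent of the value fed back (`likLaw_minus`, `likLaw_plus`). With correct
feedback each outer code thus sees its own memoryless sub-channel, whatever the other codewords are,
and a union bound over the stages suffices (`errorProb_le`). By linearity the zero message may be
assumed sent, so only the uniform law of one nonzero message's codeword is needed. It yields
Gallager's bound on the mean confusion probability and a bound on the mean of its `1 / ρ`-th power;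
Markov's inequality turns both into statements on typical codes (`tendsto_badFraction`), without
removing any codeword. Unwinding the recursion chooses the rates (`exists_rates`). -/

noncomputable section

/-! ### Functions that are convex as functions of the binary entropy -/

/-- `f` is symmetric about `1 / 2`, and convex as a function of the binary entropy. -/
structure EntropyConvex (f : ℝ → ℝ) : Prop where
  continuous : Continuous f
  symm : ∀ p ∈ Icc (0 : ℝ) 1, f (1 - p) = f p
  deriv : ∃ r : ℝ → ℝ, MonotoneOn r (Ioo 0 2⁻¹) ∧
    ∀ p ∈ Ioo (0 : ℝ) 2⁻¹, HasDerivAt f (r p * (Real.log (1 - p) - Real.log p)) p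

theorem log_one_sub_sub_log_pos {p : ℝ} (hp : p ∈ Ioo (0 : ℝ) 2⁻¹) :
    0 < Real.log (1 - p) - Real.log p := by
  have h2 := hp.2
  exact sub_pos.2 (Real.log_lt_log hp.1 (by norm_num at h2 ⊢; linarith))

/-- Cauchy's mean value theorem against the entropy, whose derivative is `log (1 - p) - log p`. So
`r` is the derivative of `f` with respect to the entropy, and its monotonicity is the convexity in
`EntropyConvex`. -/
theorem exists_sub_eq_mul_binEntropy_sub {f r : ℝ → ℝ} (hf : Continuous f)
    (hr : ∀ p ∈ Ioo (0 : ℝ) 2⁻¹, HasDerivAt f (r p * (Real.log (1 - p) - Real.log p)) p)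
    {p q : ℝ} (hp : 0 ≤ p) (hpq : p < q) (hq : q ≤ 2⁻¹) :
    ∃ c ∈ Ioo p q, f q - f p = r c * (Real.binEntropy q - Real.binEntropy p) := by
  obtain ⟨c, hc, h⟩ := exists_ratio_hasDerivAt_eq_ratio_slope f
    (fun p => r p * (Real.log (1 - p) - Real.log p)) hpq hf.continuousOn
    (fun x hx => hr x ⟨hp.trans_lt hx.1, hx.2.trans_le hq⟩) Real.binEntropy
    (fun p => Real.log (1 - p) - Real.log p) Real.binEntropy_continuous.continuousOn
    (fun x hx => Real.hasDerivAt_binEntropy (hp.trans_lt hx.1).ne' (by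
      have := hx.2.trans_le hq; norm_num at this; linarith))
  have h0 := log_one_sub_sub_log_pos (p := c) ⟨hp.trans_lt hc.1, hc.2.trans_le hq⟩
  refine ⟨c, hc, mul_right_cancel₀ h0.ne' ?_⟩
  linarith

namespace EntropyConvex

variable {f : ℝ → ℝ}

theorem exists_supporting_line (hf : EntropyConvex f) {q : ℝ} (hq : q ∈ Ioo (0 : ℝ) 2⁻¹) :
    ∃ c, ∀ p ∈ Icc (0 : ℝ) 1, f q + c * (Real.binEntropy p - Real.binEntropy q) ≤ f p := by
  obtain ⟨r, hr, hd⟩ := hf.deriv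
  have key : ∀ p ∈ Icc (0 : ℝ) 2⁻¹, f q + r q * (Real.binEntropy p - Real.binEntropy q) ≤ f p := by
    intro p hp
    rcases lt_trichotomy p q with h | rfl | h
    · obtain ⟨c, hc, e⟩ := exists_sub_eq_mul_binEntropy_sub hf.continuous hd hp.1 h hq.2.le
      have h1 := hr ⟨hp.1.trans_lt hc.1, hc.2.trans hq.2⟩ hq hc.2.le
      have h2 := Real.binEntropy_strictMonoOn hp ⟨hq.1.le, hq.2.le⟩ h
      nlinarith
    · simp
    · obtain ⟨c, hc, e⟩ := exists_sub_eq_mul_binEntropy_sub hf.continuous hd hq.1.le h hp.2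
      have h1 := hr hq ⟨hq.1.trans hc.1, hc.2.trans_le hp.2⟩ hc.1.le
      have h2 := Real.binEntropy_strictMonoOn ⟨hq.1.le, hq.2.le⟩ hp h
      nlinarith
  refine ⟨r q, fun p hp => ?_⟩
  rcases le_total p 2⁻¹ with h | h
  · exact key p ⟨hp.1, h⟩
  · have := key (1 - p) ⟨by linarith [hp.2], by norm_num at h ⊢; linarith⟩
    rwa [Real.binEntropy_one_sub, hf.symm p hp] at this

/-- The secant slopes to the left and right of `p` are values `r c ≤ r d` with `c < p < d`. The
chord joins entropy `0` to entropy `log 2`. -/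
theorem le_chord (hf : EntropyConvex f) {p : ℝ} (hp : p ∈ Icc (0 : ℝ) 1) :
    Real.log 2 * f p ≤ (Real.log 2 - Real.binEntropy p) * f 0 + Real.binEntropy p * f 2⁻¹ := by
  obtain ⟨r, hr, hd⟩ := hf.deriv
  have key : ∀ p ∈ Icc (0 : ℝ) 2⁻¹, Real.log 2 * f p ≤
      (Real.log 2 - Real.binEntropy p) * f 0 + Real.binEntropy p * f 2⁻¹ := by
    intro p hp
    rcases hp.1.eq_or_lt with rfl | h0
    · simp
    rcases hp.2.eq_or_lt with rfl | h1
    · simp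
    obtain ⟨c, hc, e⟩ := exists_sub_eq_mul_binEntropy_sub hf.continuous hd le_rfl h0 hp.2
    obtain ⟨d, hd', e'⟩ := exists_sub_eq_mul_binEntropy_sub hf.continuous hd hp.1 h1 le_rfl
    have h2 := hr ⟨hc.1, hc.2.trans h1⟩ ⟨h0.trans hd'.1, hd'.2⟩ (hc.2.trans hd'.1).le
    rw [Real.binEntropy_zero] at e
    rw [Real.binEntropy_two_inv] at e'
    have h3 := Real.binEntropy_nonneg hp.1 (hp.2.trans (by norm_num))
    have h4 : Real.binEntropy p ≤ Real.log 2 := Real.binEntropy_le_log_two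
    have h5 : f p - f 0 = r c * Real.binEntropy p := by linarith
    have h6 := mul_nonneg (mul_nonneg h3 (sub_nonneg.2 h4)) (sub_nonneg.2 h2)
    have h7 : (f p - f 0) * (Real.log 2 - Real.binEntropy p) =
      r c * Real.binEntropy p * (Real.log 2 - Real.binEntropy p) := by rw [h5]
    have h8 : (f 2⁻¹ - f p) * Real.binEntropy p =
      r d * (Real.log 2 - Real.binEntropy p) * Real.binEntropy p := by rw [e']
    nlinarith
  rcases le_total p 2⁻¹ with h | h
  · exact key p ⟨hp.1, h⟩
  · have := key (1 - p) ⟨by linarith [hp.2], by norm_num at h ⊢; linarith⟩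
    rwa [Real.binEntropy_one_sub, hf.symm p hp] at this

end EntropyConvex

theorem Continuous.integrable_comp_of_mem_unit {Ω : Type*} [MeasurableSpace Ω] {ν : Measure Ω}
    [IsFiniteMeasure ν] {f : ℝ → ℝ} (hf : Continuous f) {P : Ω → ℝ} (hP : Measurable P)
    (h01 : ∀ ω, P ω ∈ Icc (0 : ℝ) 1) : Integrable (fun ω => f (P ω)) ν := by
  obtain ⟨C, hC⟩ := (isCompact_Icc (a := (0 : ℝ)) (b := 1)).exists_bound_of_continuousOn
    hf.continuousOn
  exact Integrable.of_bound (hf.measurable.comp hP).aestronglyMeasurable C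
    (Eventually.of_forall fun ω => hC _ (h01 ω))

/-- Jensen's inequality. -/
theorem EntropyConvex.le_integral {f : ℝ → ℝ} (hf : EntropyConvex f) {Ω : Type*}
    [MeasurableSpace Ω] {ν : Measure Ω} [IsProbabilityMeasure ν] {P : Ω → ℝ} (hP : Measurable P)
    (h01 : ∀ ω, P ω ∈ Icc (0 : ℝ) 1) {q : ℝ} (hq : q ∈ Icc (0 : ℝ) 2⁻¹)
    (h : ∫ ω, Real.binEntropy (P ω) ∂ν = Real.binEntropy q) : f q ≤ ∫ ω, f (P ω) ∂ν := by
  have hi := Real.binEntropy_continuous.integrable_comp_of_mem_unit (ν := ν) hP h01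
  have hif := hf.continuous.integrable_comp_of_mem_unit (ν := ν) hP h01
  -- A supporting line is available only for `0 < q < 1/2`. At the two ends the mean entropy is
  -- extremal, so `P` is almost surely in `{0, 1}`, respectively equal to `1/2`.
  rcases hq.1.eq_or_lt with rfl | h0
  · rw [Real.binEntropy_zero, integral_eq_zero_iff_of_nonneg
      (fun ω => Real.binEntropy_nonneg (h01 ω).1 (h01 ω).2) hi] at h
    have : (fun ω => f (P ω)) =ᵐ[ν] fun _ => f 0 := by
      filter_upwards [h] with ω hω
      rcases Real.binEntropy_eq_zero.1 hω with e | e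
      · rw [e]
      · rw [e, ← hf.symm 0 (by simp), sub_zero]
    simp [integral_congr_ae this]
  rcases hq.2.eq_or_lt with rfl | h1
  · have h' : ∫ ω, (Real.log 2 - Real.binEntropy (P ω)) ∂ν = 0 := by
      rw [integral_sub (integrable_const _) hi, h, Real.binEntropy_two_inv]; simp
    rw [integral_eq_zero_iff_of_nonneg (fun ω => sub_nonneg.2 Real.binEntropy_le_log_two)
      ((integrable_const _).sub hi)] at h'
    have : (fun ω => f (P ω)) =ᵐ[ν] fun _ => f 2⁻¹ := by
      filter_upwards [h'] with ω hω
      rw [Real.binEntropy_eq_log_two.1 (sub_eq_zero.1 hω).symm]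
    simp [integral_congr_ae this]
  obtain ⟨c, hc⟩ := hf.exists_supporting_line ⟨h0, h1⟩
  have hi' : Integrable (fun ω => c * (Real.binEntropy (P ω) - Real.binEntropy q)) ν :=
    (hi.sub (integrable_const _)).const_mul _
  have := integral_mono ((integrable_const (f q)).add hi') hif
    (fun ω => hc _ (h01 ω))
  simp only [Pi.add_apply] at this
  rw [integral_add (integrable_const _) hi', integral_const_mul, integral_sub hi
    (integrable_const _), h] at this
  simpa using this

theorem ConvexOn.monotoneOn_div {φ : ℝ → ℝ} (hφ : ConvexOn ℝ (Ici 0) φ) (h0 : φ 0 = 0) :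
    MonotoneOn (fun t => φ t / t) (Ioi 0) := by
  intro x hx y hy hxy
  have := hφ.secant_mono (a := 0) (mem_Ici.2 le_rfl) (mem_Ici.2 (mem_Ioi.1 hx).le)
    (mem_Ici.2 (mem_Ioi.1 hy).le) (ne_of_gt hx) (ne_of_gt hy) hxy
  simpa [h0] using this

theorem logit_antitoneOn : AntitoneOn (fun p : ℝ => Real.log (1 - p) - Real.log p) (Ioo 0 2⁻¹) := by
  intro p hp q hq h
  have := hq.2
  norm_num at this
  exact sub_le_sub (Real.log_le_log (by linarith) (by linarith)) (Real.log_le_log hp.1 h)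

/-! #### The entropy of a cascade with a binary symmetric channel -/

/-- With `t = log ((1 - p) / p)`, this is `1 - 2a` times the log-ratio after a cascade with a BSC of
crossover probability `a`. Its derivative decreases for `t ≥ 0` because `t` enters only through
`cosh t` in the denominator. -/
theorem concaveOn_cascade_logit {a : ℝ} (ha : a ∈ Icc (0 : ℝ) 1) :
    ConcaveOn ℝ (Ici 0) fun t => (1 - 2 * a) *
      (Real.log ((1 - a) * Real.exp t + a) - Real.log (a * Real.exp t + (1 - a))) := by
  have hpos : ∀ b ∈ Icc (0 : ℝ) 1, ∀ t, 0 < (1 - b) * Real.exp t + b := by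
    intro b hb t
    rcases hb.2.eq_or_lt with rfl | h
    · simp
    · have := mul_pos (sub_pos.2 h) (Real.exp_pos t); linarith [hb.1]
  have h1 := hpos a ha
  have h2 : ∀ t, 0 < a * Real.exp t + (1 - a) := fun t => by
    simpa using hpos (1 - a) ⟨by linarith [ha.2], by linarith [ha.1]⟩ t
  have hd : ∀ t, HasDerivAt (fun t => (1 - 2 * a) *
      (Real.log ((1 - a) * Real.exp t + a) - Real.log (a * Real.exp t + (1 - a))))
      ((1 - 2 * a) ^ 2 / (a * (1 - a) * (2 * Real.cosh t) + (1 - a) ^ 2 + a ^ 2)) t := by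
    intro t
    have e1 := ((((Real.hasDerivAt_exp t).const_mul (1 - a)).add_const a).log (h1 t).ne')
    have e2 := ((((Real.hasDerivAt_exp t).const_mul a).add_const (1 - a)).log (h2 t).ne')
    refine ((e1.sub e2).const_mul (1 - 2 * a)).congr_deriv ?_
    have h3 : a * (1 - a) * (2 * Real.cosh t) + (1 - a) ^ 2 + a ^ 2 =
        ((1 - a) * Real.exp t + a) * (a * Real.exp t + (1 - a)) / Real.exp t := by
      rw [Real.cosh_eq, Real.exp_neg]; field_simp; ring
    rw [h3]
    have := h1 t; have := h2 t; have := Real.exp_pos t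
    field_simp
    ring
  refine AntitoneOn.concaveOn_of_deriv (convex_Ici 0)
    (fun t _ => (hd t).continuousAt.continuousWithinAt)
    (fun t _ => (hd t).differentiableAt.differentiableWithinAt) ?_
  intro s hs t ht hst
  rw [interior_Ici, mem_Ioi] at hs ht
  rw [(hd s).deriv, (hd t).deriv]
  have hc : Real.cosh s ≤ Real.cosh t := Real.cosh_le_cosh.2 (by
    rwa [abs_of_pos hs, abs_of_pos ht])
  have ha' : 0 ≤ a * (1 - a) := mul_nonneg ha.1 (sub_nonneg.2 ha.2)
  have : 0 < (1 - a) ^ 2 + a ^ 2 := by nlinarith [sq_nonneg (1 - 2 * a)]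
  have hcs := Real.cosh_pos s
  have hcs' := mul_nonneg ha' (mul_pos two_pos hcs).le
  refine div_le_div_of_nonneg_left (sq_nonneg _) (by linarith) ?_
  gcongr

/-- The derivative with respect to the entropy is `ψ t / t`, with `ψ` the concave function above and
`ψ 0 = 0`. It decreases in `t`, and `t` decreases in `p`. -/
theorem entropyConvex_cascade {a : ℝ} (ha : a ∈ Icc (0 : ℝ) 1) :
    EntropyConvex fun p => Real.binEntropy (a * (1 - p) + (1 - a) * p) := by
  refine ⟨by fun_prop, fun p _ => ?_, ?_⟩
  · rw [← Real.binEntropy_one_sub]; congr 1; ring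
  refine ⟨fun p => (1 - 2 * a) * (Real.log (1 - (a * (1 - p) + (1 - a) * p)) -
    Real.log (a * (1 - p) + (1 - a) * p)) / (Real.log (1 - p) - Real.log p), ?_, ?_⟩
  · have hψ := (concaveOn_cascade_logit ha).neg.monotoneOn_div (by simp)
    intro p hp q hq hpq
    have hp' := log_one_sub_sub_log_pos hp
    have hq' := log_one_sub_sub_log_pos hq
    have e := hψ hq' hp' (logit_antitoneOn hp hq hpq)
    have key : ∀ x ∈ Ioo (0 : ℝ) 2⁻¹,
        Real.log ((1 - a) * Real.exp (Real.log (1 - x) - Real.log x) + a) -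
          Real.log (a * Real.exp (Real.log (1 - x) - Real.log x) + (1 - a)) =
        Real.log (1 - (a * (1 - x) + (1 - a) * x)) - Real.log (a * (1 - x) + (1 - a) * x) := by
      intro x hx
      have hx2 := hx.2
      have hx0 := hx.1
      norm_num at hx2
      have h1 : 0 < 1 - x := by linarith
      have h2 : 0 < a * (1 - x) + (1 - a) * x := by
        rcases ha.1.eq_or_lt with rfl | h
        · simpa using hx.1
        · have := mul_pos h h1; nlinarith [mul_nonneg (sub_nonneg.2 ha.2) hx.1.le]
      have h3 : 0 < 1 - (a * (1 - x) + (1 - a) * x) := by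
        rcases ha.1.eq_or_lt with rfl | h
        · simpa using h1
        · have := mul_pos h hx.1; nlinarith [mul_nonneg (sub_nonneg.2 ha.2) h1.le]
      rw [Real.exp_sub, Real.exp_log h1, Real.exp_log hx.1]
      have e1 : (1 - a) * ((1 - x) / x) + a = (1 - (a * (1 - x) + (1 - a) * x)) / x := by
        field_simp; ring
      have e2 : a * ((1 - x) / x) + (1 - a) = (a * (1 - x) + (1 - a) * x) / x := by
        field_simp
      rw [e1, e2, Real.log_div h3.ne' hx.1.ne', Real.log_div h2.ne' hx.1.ne']
      ring
    simp only [Pi.neg_apply, key p hp, key q hq, neg_div] at e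
    exact neg_le_neg_iff.1 e
  · intro p hp
    have hp2 := hp.2
    norm_num at hp2
    have h1 : 0 < 1 - p := by linarith
    rw [div_mul_cancel₀ _ (log_one_sub_sub_log_pos hp).ne']
    have h2 : 0 < a * (1 - p) + (1 - a) * p := by
      rcases ha.1.eq_or_lt with rfl | h
      · simpa using hp.1
      · have := mul_pos h h1; nlinarith [mul_nonneg (sub_nonneg.2 ha.2) hp.1.le]
    have h3 : a * (1 - p) + (1 - a) * p < 1 := by
      rcases ha.1.eq_or_lt with rfl | h
      · linarith
      · have := mul_pos h hp.1; nlinarith [mul_nonneg (sub_nonneg.2 ha.2) h1.le]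
    have e : HasDerivAt (fun p => a * (1 - p) + (1 - a) * p) (1 - 2 * a) p := by
      have := (((hasDerivAt_id p).const_sub 1).const_mul a).add ((hasDerivAt_id p).const_mul (1 - a))
      exact this.congr_deriv (by ring)
    have := (Real.hasDerivAt_binEntropy h2.ne' h3.ne).comp p e
    rwa [mul_comm] at this

/-! #### Gallager's function of a binary symmetric channel -/

theorem convexOn_sinh_mul {a : ℝ} (ha : 0 ≤ a) : ConvexOn ℝ (Ici 0) fun t => Real.sinh (a * t) := by
  have hd : ∀ t, HasDerivAt (fun t => Real.sinh (a * t)) (Real.cosh (a * t) * a) t := fun t => by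
    have := ((hasDerivAt_id t).const_mul a).sinh
    simpa using this
  refine MonotoneOn.convexOn_of_deriv (convex_Ici 0)
    (fun t _ => (hd t).continuousAt.continuousWithinAt)
    (fun t _ => (hd t).differentiableAt.differentiableWithinAt) ?_
  intro s hs t ht hst
  rw [interior_Ici, mem_Ioi] at hs ht
  rw [(hd s).deriv, (hd t).deriv]
  refine mul_le_mul_of_nonneg_right (Real.cosh_le_cosh.2 ?_) ha
  rw [abs_of_nonneg (by positivity), abs_of_nonneg (by positivity)]
  gcongr

/-- The integrand of `exp (-E₀(W, ρ))` as a function of the posterior probability of an input. -/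
def gallagerKernel (ρ p : ℝ) : ℝ :=
  2 * ((1 / 2 : ℝ) * ((1 - p) ^ (1 / (1 + ρ)) + p ^ (1 / (1 + ρ)))) ^ (1 + ρ)

theorem continuous_gallagerKernel {ρ : ℝ} (hρ : 0 ≤ ρ) : Continuous (gallagerKernel ρ) := by
  have h : ∀ q : ℝ, 0 ≤ q → Continuous fun x : ℝ => x ^ q := fun q hq =>
    Real.continuous_rpow_const hq
  have h1 := h (1 / (1 + ρ)) (by positivity)
  have h2 := h (1 + ρ) (by positivity)
  exact continuous_const.mul (h2.comp (continuous_const.mul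
    ((h1.comp (continuous_const.sub continuous_id)).add h1)))

/-- Pulling out geometric means leaves `cosh` and `sinh` of multiples of `log ((1 - p) / p)`. The
exponential prefactors cancel because `s - 1 = -ρ s`. -/
theorem gallagerKernel_deriv_factor {ρ s p : ℝ} (hs : s * (1 + ρ) = 1)
    (hp : p ∈ Ioo (0 : ℝ) 2⁻¹) :
    ((1 / 2 : ℝ) * ((1 - p) ^ s + p ^ s)) ^ ρ * (p ^ (s - 1) - (1 - p) ^ (s - 1)) =
      Real.cosh (s / 2 * (Real.log (1 - p) - Real.log p)) ^ ρ *
        (2 * Real.sinh (ρ * s / 2 * (Real.log (1 - p) - Real.log p))) := by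
  have hp0 := hp.1
  have hp2 := hp.2
  norm_num at hp2
  have h1 : 0 < 1 - p := by linarith
  set x := Real.log (1 - p) with hx
  set y := Real.log p with hy
  have e1 : ∀ c : ℝ, (1 - p) ^ c = Real.exp (c * x) := fun c => by
    rw [Real.rpow_def_of_pos h1, mul_comm]
  have e2 : ∀ c : ℝ, p ^ c = Real.exp (c * y) := fun c => by
    rw [Real.rpow_def_of_pos hp0, mul_comm]
  have h3 : (1 / 2 : ℝ) * ((1 - p) ^ s + p ^ s) =
      Real.exp (s / 2 * (x + y)) * Real.cosh (s / 2 * (x - y)) := by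
    rw [e1, e2, Real.cosh_eq, mul_div_assoc', mul_add (Real.exp _), ← Real.exp_add, ← Real.exp_add]
    ring_nf
  rw [h3, Real.mul_rpow (Real.exp_pos _).le (Real.cosh_pos _).le, ← Real.exp_mul, e1, e2]
  have h4 : s - 1 = -(ρ * s) := by linarith
  have h5 : Real.exp ((s - 1) * y) - Real.exp ((s - 1) * x) = Real.exp (-(s / 2 * (x + y) * ρ)) *
      (2 * Real.sinh (ρ * s / 2 * (x - y))) := by
    rw [h4, Real.sinh_eq, mul_div_cancel₀ _ (two_ne_zero), mul_sub, ← Real.exp_add, ← Real.exp_add]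
    ring_nf
  rw [h5, mul_comm (Real.exp _) (_ ^ ρ), mul_assoc, ← mul_assoc (Real.exp _) (Real.exp _),
    ← Real.exp_add]
  simp

/-- In `t = log ((1 - p) / p)`, minus the slope is a product of the nonnegative increasing functions
`cosh (s t / 2) ^ ρ` and `2 sinh (ρ s t / 2) / t`; the latter increases since `sinh` is convex on `t
≥ 0` and vanishes at `0`. As `t` decreases in `p`, the slope increases. -/
theorem entropyConvex_neg_gallagerKernel {ρ : ℝ} (hρ : 0 ≤ ρ) :
    EntropyConvex fun p => -gallagerKernel ρ p := by
  refine ⟨(continuous_gallagerKernel hρ).neg, fun p _ => ?_, ?_⟩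
  · simp only [gallagerKernel, sub_sub_cancel, add_comm]
  have hρ1 : 0 < 1 + ρ := by linarith
  set s := 1 / (1 + ρ) with hs_def
  have hs : s * (1 + ρ) = 1 := by rw [hs_def]; field_simp
  have hs0 : 0 < s := by positivity
  refine ⟨fun p => -(Real.cosh (s / 2 * (Real.log (1 - p) - Real.log p)) ^ ρ *
    (2 * (Real.sinh (ρ * s / 2 * (Real.log (1 - p) - Real.log p)) /
      (Real.log (1 - p) - Real.log p)))), ?_, ?_⟩
  · intro p hp q hq hpq
    have hp' := log_one_sub_sub_log_pos hp
    have hq' := log_one_sub_sub_log_pos hq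
    have hl := logit_antitoneOn hp hq hpq
    refine neg_le_neg (mul_le_mul (Real.rpow_le_rpow (Real.cosh_pos _).le ?_ hρ) ?_ ?_ ?_)
    · rw [Real.cosh_le_cosh, abs_of_nonneg (by positivity), abs_of_nonneg (by positivity)]
      exact mul_le_mul_of_nonneg_left hl (by positivity)
    · exact mul_le_mul_of_nonneg_left ((convexOn_sinh_mul (a := ρ * s / 2)
        (by positivity)).monotoneOn_div (by simp) hq' hp' hl) (by norm_num)
    · exact mul_nonneg (by norm_num) (div_nonneg (Real.sinh_nonneg_iff.2 (by positivity)) hq'.le)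
    · exact Real.rpow_nonneg (Real.cosh_pos _).le _
  · intro p hp
    have hp0 := hp.1
    have hp2 := hp.2
    norm_num at hp2
    have h1 : 0 < 1 - p := by linarith
    have hl := log_one_sub_sub_log_pos hp
    have e1 : HasDerivAt (fun p : ℝ => p ^ s) (s * p ^ (s - 1)) p :=
      Real.hasDerivAt_rpow_const (Or.inl hp0.ne')
    have e2 : HasDerivAt (fun p : ℝ => (1 - p) ^ s) (-(s * (1 - p) ^ (s - 1))) p := by
      have := (Real.hasDerivAt_rpow_const (x := 1 - p) (p := s) (Or.inl h1.ne')).comp p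
        ((hasDerivAt_id p).const_sub 1)
      exact this.congr_deriv (by ring)
    have hpos : 0 < (1 / 2 : ℝ) * ((1 - p) ^ s + p ^ s) := by positivity
    have e3 := ((Real.hasDerivAt_rpow_const (p := 1 + ρ) (Or.inl hpos.ne')).comp p
      ((e2.add e1).const_mul (1 / 2))).const_mul (-2)
    have e4 : (fun p => -gallagerKernel ρ p) = fun p => -2 * ((fun x : ℝ => x ^ (1 + ρ)) ∘
        fun p => (1 / 2 : ℝ) * ((1 - p) ^ s + p ^ s)) p := by
      funext p; simp [gallagerKernel, hs_def]
    rw [e4]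
    refine e3.congr_deriv ?_
    have := gallagerKernel_deriv_factor hs hp
    have h6 : (1 + ρ) * s = 1 := by linarith
    have h7 : ∀ C S t : ℝ, t ≠ 0 → -(C * (2 * (S / t))) * t = -(C * (2 * S)) := fun C S t ht => by
      field_simp
    rw [add_sub_cancel_left]
    refine Eq.trans ?_ (h7 _ _ _ hl.ne').symm
    rw [← this]
    linear_combination -(((1 / 2 : ℝ) * ((1 - p) ^ s + p ^ s)) ^ ρ *
      (p ^ (s - 1) - (1 - p) ^ (s - 1))) * h6

/-! ### Symmetric channels as mixtures of binary symmetric channels -/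

theorem ZMod.sum_univ_two {M : Type*} [AddCommMonoid M] (f : ZMod 2 → M) :
    ∑ x, f x = f 0 + f 1 := Fin.sum_univ_two f

theorem integral_count_zmod_two (f : ZMod 2 → ℝ) : ∫ x, f x ∂Measure.count = f 0 + f 1 := by
  rw [integral_fintype (Integrable.of_finite), ZMod.sum_univ_two]
  simp [Measure.real]

namespace BMS

/-- The density of the channel output for a uniform input. -/
def avg (W : BMS.{u}) (y : W.Y) : ℝ≥0 := (W.w 0 y + W.w 1 y) / 2

/-- The law of the channel output for a uniform input. -/
def mix (W : BMS.{u}) : Measure W.Y := W.μ.withDensity fun y => (W.avg y : ℝ≥0∞)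

/-- The posterior probability of the input `1`. -/
def post (W : BMS.{u}) (y : W.Y) : ℝ := (W.w 1 y : ℝ) / ((W.w 0 y : ℝ) + W.w 1 y)

/-- The conditional entropy (in nats) of a uniform input given the output. -/
def equivocation (W : BMS.{u}) : ℝ := ∫ y, Real.binEntropy (W.post y) ∂W.mix

/-- `exp (-E₀(W, ρ))`. -/
def gallagerInt (W : BMS.{u}) (ρ : ℝ) : ℝ := ∫ y, gallagerKernel ρ (W.post y) ∂W.mix

variable (W : BMS.{u})

theorem measurable_avg : Measurable W.avg := ((W.measurable_w 0).add (W.measurable_w 1)).div_const 2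

instance : IsProbabilityMeasure W.mix := ⟨by
  have h0 := (W.measurable_w 0).coe_nnreal_ennreal
  have h1 := (W.measurable_w 1).coe_nnreal_ennreal
  have : ∀ y, (W.avg y : ℝ≥0∞) = 2⁻¹ * ((W.w 0 y : ℝ≥0∞) + W.w 1 y) := fun y => by
    rw [avg, ENNReal.coe_div two_ne_zero, ENNReal.div_eq_inv_mul]; simp
  rw [mix, withDensity_apply _ MeasurableSet.univ, Measure.restrict_univ]
  simp_rw [this]
  rw [lintegral_const_mul' _ _ (by simp), lintegral_add_left h0, W.lintegral_w, W.lintegral_w,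
    one_add_one_eq_two, ENNReal.inv_mul_cancel two_ne_zero ENNReal.ofNat_ne_top]⟩

theorem measurable_post : Measurable W.post :=
  (W.measurable_w 1).coe_nnreal_real.div
    ((W.measurable_w 0).coe_nnreal_real.add (W.measurable_w 1).coe_nnreal_real)

theorem post_mem (y : W.Y) : W.post y ∈ Icc (0 : ℝ) 1 :=
  ⟨by unfold post; positivity, div_le_one_of_le₀ (by simp) (by positivity)⟩

theorem coe_avg (y : W.Y) : (W.avg y : ℝ) = ((W.w 0 y : ℝ) + W.w 1 y) / 2 := by simp [avg]

theorem w_one_eq (y : W.Y) : (W.w 1 y : ℝ) = 2 * W.avg y * W.post y := by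
  rw [coe_avg, post]
  by_cases h : (W.w 0 y : ℝ) + W.w 1 y = 0
  · rw [h]; simp; have : (0 : ℝ) ≤ W.w 0 y := by positivity
    have : (0 : ℝ) ≤ W.w 1 y := by positivity
    exact NNReal.coe_eq_zero.1 (by linarith)
  · field_simp

theorem w_zero_eq (y : W.Y) : (W.w 0 y : ℝ) = 2 * W.avg y * (1 - W.post y) := by
  have := W.w_one_eq y
  have := W.coe_avg y
  linarith

theorem integral_mix (F : W.Y → ℝ) : ∫ y, F y ∂W.mix = ∫ y, (W.avg y : ℝ) * F y ∂W.μ := by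
  rw [mix, integral_withDensity_eq_integral_smul W.measurable_avg]
  rfl

theorem integrable_post {f : ℝ → ℝ} (hf : Continuous f) :
    Integrable (fun y => f (W.post y)) W.mix :=
  hf.integrable_comp_of_mem_unit W.measurable_post W.post_mem

theorem integrable_avg_mul {f : ℝ → ℝ} (hf : Continuous f) :
    Integrable (fun y => (W.avg y : ℝ) * f (W.post y)) W.μ :=
  (integrable_withDensity_iff_integrable_smul W.measurable_avg).1 (W.integrable_post hf)

theorem log_two_mul_capacity : Real.log 2 * W.capacity = Real.log 2 - W.equivocation := by
  have hl : 0 < Real.log 2 := Real.log_pos (by norm_num)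
  -- This is `p * logb 2 (2 p)`, in a form visibly continuous at `0`; continuity then gives
  -- integrability of each term.
  set φ : ℝ → ℝ := fun p => p - Real.negMulLog p / Real.log 2 with hφ
  have hφc : Continuous φ := by fun_prop
  have hφc' : Continuous fun p => φ (1 - p) := by fun_prop
  have hφe : ∀ a p : ℝ, 0 ≤ a → 0 ≤ p →
      1 / 2 * (2 * a * p) * Real.logb 2 (2 * a * p / a) = a * φ p := by
    intro a p ha hp
    rcases ha.eq_or_lt with rfl | ha
    · simp
    rcases hp.eq_or_lt with rfl | hp
    · simp [hφ]
    have : 2 * a * p / a = 2 * p := by field_simp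
    rw [this, Real.logb, Real.log_mul two_ne_zero hp.ne']
    simp only [hφ, Real.negMulLog]
    field_simp
    ring
  have hs : ∀ y, (∑ x' : ZMod 2, (1 / 2 : ℝ) * (W.w x' y : ℝ)) = W.avg y := fun y => by
    rw [ZMod.sum_univ_two, coe_avg]; ring
  have h1 : ∀ y, 1 / 2 * (W.w 1 y : ℝ) * Real.logb 2 (W.w 1 y / W.avg y) =
      W.avg y * φ (W.post y) := fun y => by
    rw [W.w_one_eq]; exact hφe _ _ (by positivity) (W.post_mem y).1
  have h0 : ∀ y, 1 / 2 * (W.w 0 y : ℝ) * Real.logb 2 (W.w 0 y / W.avg y) =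
      W.avg y * φ (1 - W.post y) := fun y => by
    rw [W.w_zero_eq]; exact hφe _ _ (by positivity) (sub_nonneg.2 (W.post_mem y).2)
  rw [capacity, ZMod.sum_univ_two]
  simp_rw [hs, h0, h1]
  rw [← W.integral_mix fun y => φ (1 - W.post y), ← W.integral_mix fun y => φ (W.post y),
    ← integral_add (W.integrable_post hφc') (W.integrable_post hφc), equivocation,
    ← integral_const_mul]
  have : Real.log 2 = ∫ _, Real.log 2 ∂W.mix := by simp
  conv_rhs => rw [this]
  rw [← integral_sub (integrable_const _) (W.integrable_post Real.binEntropy_continuous)]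
  congr 1
  funext y
  rw [Real.binEntropy_eq_negMulLog_add_negMulLog_one_sub]
  simp only [hφ]
  field_simp
  ring

/-- The integrand is homogeneous of degree one in the two densities, so `2 * avg` factors out. -/
theorem gallagerInt_eq {ρ : ℝ} (hρ : 0 ≤ ρ) : W.gallagerInt ρ =
    ∫ y, ((1 / 2 : ℝ) * ((W.w 0 y : ℝ) ^ (1 / (1 + ρ)) + (W.w 1 y : ℝ) ^ (1 / (1 + ρ))))
      ^ (1 + ρ) ∂W.μ := by
  rw [gallagerInt, integral_mix]
  congr 1
  funext y
  have hρ1 : 0 < 1 + ρ := by linarith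
  have hp := W.post_mem y
  have hp' := sub_nonneg.2 hp.2
  have ha : (0 : ℝ) ≤ 2 * W.avg y := by positivity
  rw [W.w_one_eq, W.w_zero_eq, Real.mul_rpow ha hp', Real.mul_rpow ha hp.1, ← mul_add,
    mul_left_comm, Real.mul_rpow (by positivity)
    (mul_nonneg (by norm_num) (add_nonneg (Real.rpow_nonneg hp' _) (Real.rpow_nonneg hp.1 _))),
    ← Real.rpow_mul ha, one_div_mul_cancel hρ1.ne', Real.rpow_one, gallagerKernel]
  ring

theorem gallagerE0_eq {ρ : ℝ} (hρ : 0 ≤ ρ) : W.gallagerE0 ρ = -Real.log (W.gallagerInt ρ) := by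
  rw [gallagerInt_eq W hρ, gallagerE0]

theorem gallagerInt_pos {ρ : ℝ} (hρ : 0 ≤ ρ) : 0 < W.gallagerInt ρ := by
  have hc := continuous_gallagerKernel hρ
  obtain ⟨p, hp, hm⟩ := (isCompact_Icc (a := (0 : ℝ)) (b := 1)).exists_isMinOn
    ⟨0, by simp⟩ hc.continuousOn
  have hpos : 0 < gallagerKernel ρ p := by
    have h1 : 0 ≤ (1 - p) ^ (1 / (1 + ρ)) := Real.rpow_nonneg (sub_nonneg.2 hp.2) _
    have h2 : 0 ≤ p ^ (1 / (1 + ρ)) := Real.rpow_nonneg hp.1 _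
    have : 0 < (1 - p) ^ (1 / (1 + ρ)) + p ^ (1 / (1 + ρ)) := by
      rcases hp.1.eq_or_lt with h | h
      · have : (0 : ℝ) < (1 - p) ^ (1 / (1 + ρ)) := Real.rpow_pos_of_pos (by linarith) _
        linarith
      · have := Real.rpow_pos_of_pos h (1 / (1 + ρ))
        linarith
    unfold gallagerKernel
    positivity
  calc 0 < gallagerKernel ρ p := hpos
    _ = ∫ _, gallagerKernel ρ p ∂W.mix := by simp
    _ ≤ _ := integral_mono (integrable_const _) (W.integrable_post hc)
      fun y => hm (W.post_mem y)

theorem bhattacharyya_nonneg : 0 ≤ W.bhattacharyya := integral_nonneg fun _ => Real.sqrt_nonneg _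

/-- Reduces the comparison of Bhattacharyya parameters, hence of expurgated exponents, to the
comparison of Gallager integrals at `ρ = 1`. -/
theorem gallagerInt_one : W.gallagerInt 1 = (1 + W.bhattacharyya) / 2 := by
  have hk : ∀ p ∈ Icc (0 : ℝ) 1, gallagerKernel 1 p = 1 / 2 + √(p * (1 - p)) := by
    intro p hp
    have hp' := sub_nonneg.2 hp.2
    have e : (1 : ℝ) + 1 = 2 := by norm_num
    rw [gallagerKernel, e, ← Real.sqrt_eq_rpow, ← Real.sqrt_eq_rpow, Real.sqrt_mul hp.1,
      Real.rpow_two]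
    have e1 := Real.sq_sqrt hp.1
    have e2 := Real.sq_sqrt hp'
    linear_combination (1 / 2) * e1 + (1 / 2) * e2
  have hc : Continuous fun p : ℝ => √(p * (1 - p)) := by fun_prop
  have hz : W.bhattacharyya = 2 * ∫ y, √(W.post y * (1 - W.post y)) ∂W.mix := by
    rw [integral_mix, bhattacharyya, ← integral_const_mul]
    congr 1
    funext y
    have ha : (0 : ℝ) ≤ 2 * W.avg y := by positivity
    rw [W.w_one_eq, W.w_zero_eq, show 2 * (W.avg y : ℝ) * (1 - W.post y) *
      (2 * W.avg y * W.post y) = (2 * W.avg y) ^ 2 * (W.post y * (1 - W.post y)) by ring,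
      Real.sqrt_mul (sq_nonneg _), Real.sqrt_sq ha, mul_assoc]
  rw [gallagerInt, hz]
  simp_rw [fun y => hk _ (W.post_mem y)]
  rw [integral_add (integrable_const _) (W.integrable_post hc)]
  simp
  ring

theorem bsc_w {p : ℝ} (hp : p ∈ Icc (0 : ℝ) 1) (x y : ZMod 2) :
    ((bsc p hp).w x y : ℝ) = if y = x then 1 - p else p := by
  by_cases h : y = x
  · exact (congrArg NNReal.toReal (if_pos h)).trans (if_pos h).symm
  · exact (congrArg NNReal.toReal (if_neg h)).trans (if_neg h).symm

theorem gallagerInt_bsc {p : ℝ} (hp : p ∈ Icc (0 : ℝ) 1) {ρ : ℝ} (hρ : 0 ≤ ρ) :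
    (bsc p hp).gallagerInt ρ = gallagerKernel ρ p := by
  rw [gallagerInt_eq _ hρ]
  refine (integral_count_zmod_two _).trans ?_
  rw [bsc_w, bsc_w, bsc_w, bsc_w, if_pos rfl, if_neg (by decide), if_neg (by decide), if_pos rfl,
    gallagerKernel, add_comm (p ^ _), two_mul]

/-! ### Binary symmetric channels are the worst channels of a given capacity -/

theorem equivocation_nonneg : 0 ≤ W.equivocation :=
  integral_nonneg fun y => Real.binEntropy_nonneg (W.post_mem y).1 (W.post_mem y).2

theorem equivocation_le : W.equivocation ≤ Real.log 2 := by
  calc W.equivocation ≤ ∫ _, Real.log 2 ∂W.mix := integral_mono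
        (W.integrable_post Real.binEntropy_continuous) (integrable_const _)
        fun y => Real.binEntropy_le_log_two
    _ = Real.log 2 := by simp

theorem one_sub_capacity_mem : 1 - W.capacity ∈ Icc (0 : ℝ) 1 := by
  have hl : 0 < Real.log 2 := Real.log_pos (by norm_num)
  have h := W.log_two_mul_capacity
  have h0 := W.equivocation_nonneg
  have h1 := W.equivocation_le
  constructor <;> by_contra! hc <;> nlinarith

theorem _root_.h₂_h₂Inv {y : ℝ} (hy : y ∈ Icc (0 : ℝ) 1) : h₂ (h₂Inv y) = y := by
  have hl : 0 < Real.log 2 := Real.log_pos (by norm_num)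
  obtain ⟨p, hp, rfl⟩ : y ∈ h₂ '' Icc (0 : ℝ) (1 / 2) := by
    refine intermediate_value_Icc (by norm_num) ?_ ?_
    · exact (Real.binEntropy_continuous.div_const _).continuousOn
    · simpa [h₂, div_self hl.ne'] using hy
  rw [h₂Inv_h₂ hp]

theorem binEntropy_h₂Inv : Real.binEntropy (h₂Inv (1 - W.capacity)) = W.equivocation := by
  have hl : 0 < Real.log 2 := Real.log_pos (by norm_num)
  have h := h₂_h₂Inv W.one_sub_capacity_mem
  rw [h₂, div_eq_iff hl.ne'] at h
  rw [h]
  linarith [W.log_two_mul_capacity]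

/-- The left side is the mean of `f (post)` for the BSC of the same capacity, whose posterior is
constant up to `p ↦ 1 - p`. -/
theorem _root_.EntropyConvex.le_integral_post {f : ℝ → ℝ} (hf : EntropyConvex f) :
    f (h₂Inv (1 - W.capacity)) ≤ ∫ y, f (W.post y) ∂W.mix :=
  hf.le_integral W.measurable_post W.post_mem (by simpa using h₂Inv_mem (1 - W.capacity))
    W.binEntropy_h₂Inv.symm

theorem gallagerInt_le {ρ : ℝ} (hρ : 0 ≤ ρ) :
    W.gallagerInt ρ ≤ gallagerKernel ρ (h₂Inv (1 - W.capacity)) := by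
  have := (entropyConvex_neg_gallagerKernel hρ).le_integral_post W
  rw [integral_neg] at this
  exact neg_le_neg_iff.1 this

theorem EBSC_le_E (R : ℝ) : EBSC W.capacity R ≤ W.E R := by
  rw [EBSC, E, E]
  have hm := h₂Inv_mem_unit (1 - W.capacity)
  set V := bsc _ hm with hV
  have hle : ∀ ρ, 0 ≤ ρ → W.gallagerInt ρ ≤ V.gallagerInt ρ := fun ρ hρ => by
    rw [hV, gallagerInt_bsc hm hρ]; exact W.gallagerInt_le hρ
  refine max_le_max ?_ ?_
  · unfold Er
    split_ifs
    · exact le_rfl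
    · refine iSup₂_mono fun ρ hρ => EReal.coe_le_coe_iff.2 (sub_le_sub_right ?_ _)
      rw [gallagerE0_eq _ hρ.1, gallagerE0_eq _ hρ.1]
      exact neg_le_neg (Real.log_le_log (W.gallagerInt_pos hρ.1) (hle ρ hρ.1))
  · refine iSup₂_mono fun ρ hρ => EReal.coe_le_coe_iff.2 (sub_le_sub_right ?_ _)
    have hρ0 : 0 < ρ := one_pos.trans_le hρ
    have hz : W.bhattacharyya ≤ V.bhattacharyya := by
      have := hle 1 zero_le_one
      rw [gallagerInt_one, gallagerInt_one] at this
      linarith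
    have hw := Real.rpow_nonneg W.bhattacharyya_nonneg (1 / ρ)
    rw [gallagerEx, gallagerEx, neg_mul, neg_mul]
    refine neg_le_neg (mul_le_mul_of_nonneg_left (Real.log_le_log (by positivity) ?_) hρ0.le)
    gcongr
    exact W.bhattacharyya_nonneg

/-! ### The capacities of the polarized channels -/

theorem minus_w (c : ZMod 2) (z : W.Y × W.Y) :
    (W.minus.w c z : ℝ) = 1 / 2 * (W.w c z.1 * W.w 0 z.2 + W.w (c + 1) z.1 * W.w 1 z.2) := by
  simp only [minus]
  rw [ZMod.sum_univ_two]
  push_cast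
  rw [add_zero]
  ring

theorem avg_minus (z : W.Y × W.Y) : W.minus.avg z = W.avg z.1 * W.avg z.2 := by
  refine NNReal.coe_injective ((W.minus.coe_avg z).trans ?_)
  rw [minus_w, minus_w, NNReal.coe_mul, coe_avg, coe_avg, show (1 : ZMod 2) + 1 = 0 by decide, zero_add]
  ring

/-- The posterior of `W⁻` is that of the modulo-two sum of two independent bits. -/
theorem avg_mul_post_minus (f : ℝ → ℝ) (z : W.Y × W.Y) :
    (W.minus.avg z : ℝ) * f (W.minus.post z) = ((W.avg z.1 * W.avg z.2 : ℝ≥0) : ℝ) *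
      f (W.post z.1 * (1 - W.post z.2) + (1 - W.post z.1) * W.post z.2) := by
  rw [avg_minus]
  by_cases h1 : W.avg z.1 = 0
  · simp [h1]
  by_cases h2 : W.avg z.2 = 0
  · simp [h2]
  congr 2
  have h := W.minus.w_one_eq z
  rw [avg_minus, minus_w, show (1 : ZMod 2) + 1 = 0 by decide, w_one_eq, w_one_eq, w_zero_eq,
    w_zero_eq] at h
  have h1' : (W.avg z.1 : ℝ) ≠ 0 := by exact_mod_cast h1
  have h2' : (W.avg z.2 : ℝ) ≠ 0 := by exact_mod_cast h2
  have h3 : (2 * (W.avg z.1 : ℝ) * W.avg z.2) ≠ 0 := by positivity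
  refine mul_left_cancel₀ h3 ?_
  push_cast at h
  linarith

theorem cascade_mem {a b : ℝ} (ha : a ∈ Icc (0 : ℝ) 1) (hb : b ∈ Icc (0 : ℝ) 1) :
    a * (1 - b) + (1 - a) * b ∈ Icc (0 : ℝ) 1 := by
  obtain ⟨a0, a1⟩ := ha
  obtain ⟨b0, b1⟩ := hb
  constructor <;> nlinarith [mul_nonneg a0 b0, mul_nonneg a0 (sub_nonneg.2 b1),
    mul_nonneg (sub_nonneg.2 a1) b0, mul_nonneg (sub_nonneg.2 a1) (sub_nonneg.2 b1)]

theorem integrable_cascade : Integrable (fun z : W.Y × W.Y => Real.binEntropy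
    (W.post z.2 * (1 - W.post z.1) + (1 - W.post z.2) * W.post z.1)) (W.mix.prod W.mix) := by
  have h1 : Measurable fun z : W.Y × W.Y => W.post z.1 := W.measurable_post.comp measurable_fst
  have h2 : Measurable fun z : W.Y × W.Y => W.post z.2 := W.measurable_post.comp measurable_snd
  exact Real.binEntropy_continuous.integrable_comp_of_mem_unit
    ((h2.mul (h1.const_sub 1)).add ((h2.const_sub 1).mul h1))
    fun z => cascade_mem (W.post_mem z.2) (W.post_mem z.1)

theorem equivocation_minus : W.minus.equivocation = ∫ y₂, ∫ y₁, Real.binEntropy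
    (W.post y₂ * (1 - W.post y₁) + (1 - W.post y₂) * W.post y₁) ∂W.mix ∂W.mix := by
  rw [← integral_prod_symm _ W.integrable_cascade, equivocation, integral_mix]
  have h := W.measurable_avg
  have h' := h.coe_nnreal_ennreal
  have hm : Measurable fun z : W.Y × W.Y => W.avg z.1 * W.avg z.2 :=
    (h.comp measurable_fst).mul (h.comp measurable_snd)
  have hp : W.mix.prod W.mix = (W.μ.prod W.μ).withDensity
      fun z => ((W.avg z.1 * W.avg z.2 : ℝ≥0) : ℝ≥0∞) := by
    rw [mix, prod_withDensity h' h']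
    simp_rw [ENNReal.coe_mul]
  rw [hp, integral_withDensity_eq_integral_smul hm]
  refine integral_congr_ae (Eventually.of_forall fun z => ?_)
  refine (W.avg_mul_post_minus Real.binEntropy z).trans ?_
  simp only [NNReal.smul_def, smul_eq_mul]
  congr 2
  ring

/-- The two independent posteriors are replaced by the constant `q` one at a time, with the cascade
symmetric in its two arguments. -/
theorem le_equivocation_minus_of_forall {q : ℝ} (hq : q ∈ Icc (0 : ℝ) 1)
    (hf : ∀ a ∈ Icc (0 : ℝ) 1, Real.binEntropy (a * (1 - q) + (1 - a) * q) ≤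
      ∫ y, Real.binEntropy (a * (1 - W.post y) + (1 - a) * W.post y) ∂W.mix) :
    Real.binEntropy (q * (2 - 2 * q)) ≤ W.minus.equivocation := by
  have hf' : ∀ y, Real.binEntropy (q * (1 - W.post y) + (1 - q) * W.post y) ≤
      ∫ z, Real.binEntropy (W.post y * (1 - W.post z) + (1 - W.post y) * W.post z) ∂W.mix := by
    intro y
    have h := hf (W.post y) (W.post_mem y)
    rwa [show W.post y * (1 - q) + (1 - W.post y) * q =
      q * (1 - W.post y) + (1 - q) * W.post y by ring] at h
  have hi : Integrable (fun y => Real.binEntropy (q * (1 - W.post y) + (1 - q) * W.post y))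
    W.mix := W.integrable_post (f := fun p => Real.binEntropy (q * (1 - p) + (1 - q) * p))
      (entropyConvex_cascade hq).continuous
  have hi' : Integrable (fun y => ∫ z, Real.binEntropy
      (W.post y * (1 - W.post z) + (1 - W.post y) * W.post z) ∂W.mix) W.mix :=
    W.integrable_cascade.integral_prod_right
  have e : q * (2 - 2 * q) = q * (1 - q) + (1 - q) * q := by ring
  rw [equivocation_minus, e]
  exact (hf q hq).trans (integral_mono hi hi' hf')

theorem le_equivocation_minus : Real.binEntropy (h₂Inv (1 - W.capacity) *
    (2 - 2 * h₂Inv (1 - W.capacity))) ≤ W.minus.equivocation :=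
  W.le_equivocation_minus_of_forall (h₂Inv_mem_unit _)
    fun _ ha => (entropyConvex_cascade ha).le_integral_post W

/-- The chord bound is averaged over one posterior, then over the other. In bits it reads `H⁻ ≤ 2H -
H²`, which gives `ε_h`. -/
theorem equivocation_minus_le : Real.log 2 * W.minus.equivocation ≤
    (Real.log 2 - W.equivocation) * W.equivocation + W.equivocation * Real.log 2 := by
  have hb := W.integrable_post Real.binEntropy_continuous
  have key : ∀ a ∈ Icc (0 : ℝ) 1,
      Real.log 2 * ∫ y, Real.binEntropy (a * (1 - W.post y) + (1 - a) * W.post y) ∂W.mix ≤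
        (Real.log 2 - W.equivocation) * Real.binEntropy a + W.equivocation * Real.log 2 := by
    intro a ha
    have hc := entropyConvex_cascade ha
    have h0 : a * (1 - 0) + (1 - a) * 0 = a := by ring
    have h1 : a * (1 - 2⁻¹) + (1 - a) * 2⁻¹ = 2⁻¹ := by ring
    have h2 : Integrable (fun y => (Real.log 2 - Real.binEntropy (W.post y)) * Real.binEntropy a)
        W.mix := ((integrable_const _).sub hb).mul_const _
    have h := integral_mono ((W.integrable_post hc.continuous).const_mul (Real.log 2))
      (h2.add (hb.mul_const (Real.log 2))) fun y => by
          have := hc.le_chord (W.post_mem y)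
          rwa [h0, h1, Real.binEntropy_two_inv] at this
    rw [integral_const_mul] at h
    refine h.trans (le_of_eq ?_)
    simp only [Pi.add_apply]
    rw [integral_add h2 (hb.mul_const (Real.log 2)), integral_mul_const, integral_mul_const,
      integral_sub (integrable_const _) hb]
    simp [equivocation]
  rw [equivocation_minus, ← integral_const_mul]
  refine (integral_mono (W.integrable_cascade.integral_prod_right.const_mul (Real.log 2))
    ((hb.const_mul (Real.log 2 - W.equivocation)).add (integrable_const _))
    fun y => key _ (W.post_mem y)).trans (le_of_eq ?_)
  simp only [Pi.add_apply]
  rw [integral_add (hb.const_mul _) (integrable_const _), integral_const_mul]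
  simp [equivocation]

/-! ### The chain rule for the equivocation -/

theorem half_sum_mul_binEntropy {a b : ℝ} (ha : 0 ≤ a) (hb : 0 ≤ b) :
    (a + b) / 2 * Real.binEntropy (b / (a + b)) =
      (Real.negMulLog a + Real.negMulLog b - Real.negMulLog (a + b)) / 2 := by
  rcases (add_nonneg ha hb).eq_or_lt with h | h
  · have h1 : a = 0 := by linarith
    have h2 : b = 0 := by linarith
    simp [h1, h2]
  have e1 := Real.negMulLog_mul (a + b) (b / (a + b))
  have e2 := Real.negMulLog_mul (a + b) (a / (a + b))
  rw [mul_div_cancel₀ _ h.ne'] at e1 e2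
  have e3 : 1 - b / (a + b) = a / (a + b) := by field_simp; ring
  have e4 : b / (a + b) + a / (a + b) = 1 := by rw [← e3]; ring
  rw [Real.binEntropy_eq_negMulLog_add_negMulLog_one_sub, e3, e1, e2]
  linear_combination -(Real.negMulLog (a + b) / 2) * e4

/-- Free of the quotient in `post`, this form makes the chain rule a pointwise algebraic identity in
the densities. -/
theorem equivocation_eq : W.equivocation = ∫ y, (Real.negMulLog (W.w 0 y) +
    Real.negMulLog (W.w 1 y) - Real.negMulLog (W.w 0 y + W.w 1 y)) / 2 ∂W.μ := by
  rw [equivocation, integral_mix]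
  congr 1
  funext y
  rw [← half_sum_mul_binEntropy (by positivity) (by positivity), coe_avg, post]

theorem integrable_equivocation : Integrable (fun y => (Real.negMulLog (W.w 0 y) +
    Real.negMulLog (W.w 1 y) - Real.negMulLog (W.w 0 y + W.w 1 y)) / 2) W.μ := by
  refine (W.integrable_avg_mul Real.binEntropy_continuous).congr (Eventually.of_forall fun y => ?_)
  simp only
  rw [← half_sum_mul_binEntropy (by positivity) (by positivity), coe_avg, post]

theorem plus_w (c v : ZMod 2) (z : W.Y × W.Y) :
    (W.plus.w c (z, v) : ℝ) = 1 / 2 * (W.w (v + c) z.1 * W.w c z.2) := by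
  simp [plus]

/-- The chain rule for the pair of inputs of a polarization step, pointwise. -/
theorem negMulLog_chain (a₀ a₁ b₀ b₁ : ℝ) :
    let η := Real.negMulLog
    let J := fun a b => (η a + η b - η (a + b)) / 2
    J (1 / 2 * (a₀ * b₀ + a₁ * b₁)) (1 / 2 * (a₁ * b₀ + a₀ * b₁)) +
      (J (1 / 2 * (a₀ * b₀)) (1 / 2 * (a₁ * b₁)) + J (1 / 2 * (a₁ * b₀)) (1 / 2 * (a₀ * b₁))) =
      (a₀ + a₁) / 2 * J b₀ b₁ + (b₀ + b₁) / 2 * J a₀ a₁ := by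
  intro η J
  have e : 1 / 2 * (a₀ * b₀ + a₁ * b₁) + 1 / 2 * (a₁ * b₀ + a₀ * b₁) =
    1 / 2 * ((a₀ + a₁) * (b₀ + b₁)) := by ring
  have e1 : 1 / 2 * (a₀ * b₀) + 1 / 2 * (a₁ * b₁) = 1 / 2 * (a₀ * b₀ + a₁ * b₁) := by ring
  have e2 : 1 / 2 * (a₁ * b₀) + 1 / 2 * (a₀ * b₁) = 1 / 2 * (a₁ * b₀ + a₀ * b₁) := by ring
  -- The `negMulLog` terms of the two densities of `W⁻` now cancel against the sums in the `W⁺`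
  -- terms; the product rule for `negMulLog` does the rest.
  simp only [J, e, e1, e2]
  simp only [η, Real.negMulLog_mul (1 / 2) (_ * _), Real.negMulLog_mul a₀, Real.negMulLog_mul a₁,
    Real.negMulLog_mul (a₀ + a₁)]
  ring

theorem equivocation_chain (z : W.Y × W.Y) :
    (Real.negMulLog (W.minus.w 0 z) + Real.negMulLog (W.minus.w 1 z) -
      Real.negMulLog (W.minus.w 0 z + W.minus.w 1 z)) / 2 +
    ∫ v, (Real.negMulLog (W.plus.w 0 (z, v)) + Real.negMulLog (W.plus.w 1 (z, v)) -
      Real.negMulLog (W.plus.w 0 (z, v) + W.plus.w 1 (z, v))) / 2 ∂Measure.count =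
    (W.avg z.1 : ℝ) * ((Real.negMulLog (W.w 0 z.2) +
      Real.negMulLog (W.w 1 z.2) - Real.negMulLog (W.w 0 z.2 + W.w 1 z.2)) / 2) +
    (Real.negMulLog (W.w 0 z.1) +
      Real.negMulLog (W.w 1 z.1) - Real.negMulLog (W.w 0 z.1 + W.w 1 z.1)) / 2 * W.avg z.2 := by
  have h11 : (1 : ZMod 2) + 1 = 0 := by decide
  rw [integral_count_zmod_two, minus_w, minus_w, plus_w, plus_w, plus_w, plus_w, coe_avg, coe_avg,
    h11, zero_add, zero_add, add_zero]
  refine (negMulLog_chain _ _ _ _).trans ?_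
  ring

theorem equivocation_minus_add_plus :
    W.minus.equivocation + W.plus.equivocation = 2 * W.equivocation := by
  have hm := W.minus.integrable_equivocation
  have hp := W.plus.integrable_equivocation
  have hp' : Integrable (fun z : W.Y × W.Y => ∫ v, (Real.negMulLog (W.plus.w 0 (z, v)) +
      Real.negMulLog (W.plus.w 1 (z, v)) -
      Real.negMulLog (W.plus.w 0 (z, v) + W.plus.w 1 (z, v))) / 2 ∂Measure.count)
      (W.μ.prod W.μ) := hp.integral_prod_left
  have hA : Integrable (fun y => (W.avg y : ℝ)) W.μ := by
    simpa using W.integrable_avg_mul (f := fun _ => 1) continuous_const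
  have hJ := W.integrable_equivocation
  have hA1 : ∫ y, (W.avg y : ℝ) ∂W.μ = 1 := by
    have := W.integral_mix fun _ => 1
    simpa using this.symm
  have e := (integral_prod _ hp).symm
  rw [equivocation_eq, equivocation_eq W.plus]
  refine (congrArg _ e.symm).trans ((integral_add hm hp').symm.trans ?_)
  refine (integral_congr_ae (Eventually.of_forall W.equivocation_chain)).trans ?_
  refine (integral_add (hA.mul_prod hJ) (hJ.mul_prod hA)).trans ?_
  have e1 := integral_prod_mul (μ := W.μ) (ν := W.μ) (fun y => (W.avg y : ℝ))
    fun y => (Real.negMulLog (W.w 0 y) + Real.negMulLog (W.w 1 y) -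
      Real.negMulLog (W.w 0 y + W.w 1 y)) / 2
  have e2 := integral_prod_mul (μ := W.μ) (ν := W.μ) (fun y => (Real.negMulLog (W.w 0 y) +
    Real.negMulLog (W.w 1 y) - Real.negMulLog (W.w 0 y + W.w 1 y)) / 2) fun y => (W.avg y : ℝ)
  refine (congrArg₂ _ e1 e2).trans ?_
  rw [hA1, ← equivocation_eq]
  ring

/-- The capacities of the polarized channels differ from that of `W` by a gap in
`[ε_l(I), ε_h(I)]`. -/
theorem exists_gap : ∃ ε ∈ Icc (gapLow W.capacity) (gapHigh W.capacity),
    W.minus.capacity = W.capacity - ε ∧ W.plus.capacity = W.capacity + ε := by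
  have hl : 0 < Real.log 2 := Real.log_pos (by norm_num)
  have e0 := W.log_two_mul_capacity
  have e1 := W.minus.log_two_mul_capacity
  have e2 := W.plus.log_two_mul_capacity
  have e3 := W.equivocation_minus_add_plus
  have h1 := W.le_equivocation_minus
  have h2 := W.equivocation_minus_le
  refine ⟨W.capacity - W.minus.capacity, ⟨?_, ?_⟩, by ring, ?_⟩
  · rw [gapLow, h₂]
    have : Real.binEntropy (h₂Inv (1 - W.capacity) * (2 - 2 * h₂Inv (1 - W.capacity))) /
        Real.log 2 ≤ 1 - W.minus.capacity := by
      rw [div_le_iff₀ hl]; linarith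
    linarith
  · rw [gapHigh]
    have h3 : W.equivocation = Real.log 2 * (1 - W.capacity) := by linarith
    have h4 : W.minus.equivocation = Real.log 2 * (1 - W.minus.capacity) := by linarith
    rw [h3, h4] at h2
    have h5 : (Real.log 2 * Real.log 2) * (1 - W.minus.capacity) ≤
        (Real.log 2 * Real.log 2) * (1 - W.capacity ^ 2) := by linarith
    have := le_of_mul_le_mul_left h5 (by positivity)
    linarith
  · refine mul_left_cancel₀ hl.ne' ?_
    linarith

/-- The minimum over `ε` is at most its value at the true gap. There the arguments are the
capacities of `W⁻` and `W⁺`, and the induction hypothesis applies to both for every split. -/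
theorem capacityExponent_le_polarExponent (l : ℕ) (R : ℝ) :
    capacityExponent l W.capacity R ≤ W.polarExponent l R := by
  induction l generalizing W R with
  | zero => exact W.EBSC_le_E R
  | succ l ih =>
    obtain ⟨ε, hε, hm, hp⟩ := W.exists_gap
    rw [capacityExponent, polarExponent]
    refine mul_le_mul_of_nonneg_left ?_ (by simp)
    refine (iInf₂_le ε hε).trans (iSup₂_mono fun R₁ _ => ?_)
    rw [← hm, ← hp]
    exact min_le_min (ih _ _) (ih _ _)

end BMS

/-! ### Likelihoods -/

/-- The likelihoods of an input of `W⁻`, given those of the two channel uses. -/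
def minusLik (p : (ZMod 2 → ℝ≥0) × (ZMod 2 → ℝ≥0)) : ZMod 2 → ℝ≥0 :=
  fun u => ∑ b : ZMod 2, (1 / 2) * (p.1 (u + b) * p.2 b)

/-- The likelihoods of an input of `W⁺`, given those of the two channel uses and the first
input. -/
def plusLik (v : ZMod 2) (p : (ZMod 2 → ℝ≥0) × (ZMod 2 → ℝ≥0)) : ZMod 2 → ℝ≥0 :=
  fun u => (1 / 2) * (p.1 (v + u) * p.2 u)

/-- The likelihoods after a shift of the input by `b`. -/
def shiftLik (b : ZMod 2) (p : ZMod 2 → ℝ≥0) : ZMod 2 → ℝ≥0 := fun u => p (u + b)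

theorem measurable_minusLik : Measurable minusLik := by
  unfold minusLik; fun_prop

theorem measurable_plusLik (v : ZMod 2) : Measurable (plusLik v) := by
  unfold plusLik; fun_prop

theorem measurable_shiftLik (b : ZMod 2) : Measurable (shiftLik b) := by
  unfold shiftLik; fun_prop

theorem minusLik_shift (b : ZMod 2) (p : (ZMod 2 → ℝ≥0) × (ZMod 2 → ℝ≥0)) :
    minusLik (shiftLik b p.1, shiftLik b p.2) = minusLik p := by
  funext u
  simp only [minusLik, shiftLik]
  exact Fintype.sum_equiv (Equiv.addRight b) _ _ fun a => by simp [add_assoc]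

theorem plusLik_shift (v : ZMod 2) (p : (ZMod 2 → ℝ≥0) × (ZMod 2 → ℝ≥0)) :
    plusLik v (shiftLik v p.1, p.2) = plusLik 0 p := by
  funext u
  simp only [plusLik, shiftLik]
  congr 3
  rw [add_right_comm, CharTwo.add_self_eq_zero]

namespace BMS

variable (W : BMS.{u})

/-- The likelihoods of the channel output `y`. -/
def lik (y : W.Y) : ZMod 2 → ℝ≥0 := fun x => W.w x y

/-- The law of the likelihoods when the input bit is `x`. -/
def likLaw (x : ZMod 2) : Measure (ZMod 2 → ℝ≥0) := (W.law x).map W.lik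

theorem measurable_lik : Measurable W.lik := measurable_pi_lambda _ fun x => W.measurable_w x

instance (x : ZMod 2) : IsProbabilityMeasure (W.law x) := ⟨by
  rw [law, withDensity_apply _ MeasurableSet.univ, Measure.restrict_univ, W.lintegral_w]⟩

instance (x : ZMod 2) : IsProbabilityMeasure (W.likLaw x) :=
  Measure.isProbabilityMeasure_map W.measurable_lik.aemeasurable

theorem lintegral_likLaw (x : ZMod 2) {F : (ZMod 2 → ℝ≥0) → ℝ≥0∞} (hF : Measurable F) :
    ∫⁻ p, F p ∂W.likLaw x = ∫⁻ y, (W.w x y : ℝ≥0∞) * F (W.lik y) ∂W.μ := by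
  rw [likLaw, lintegral_map hF W.measurable_lik, law]
  exact lintegral_withDensity_eq_lintegral_mul _
    (W.measurable_w x).coe_nnreal_ennreal (hF.comp W.measurable_lik)

theorem lintegral_likLaw_prod (a b : ZMod 2) {F : (ZMod 2 → ℝ≥0) × (ZMod 2 → ℝ≥0) → ℝ≥0∞}
    (hF : Measurable F) : ∫⁻ p, F p ∂(W.likLaw a).prod (W.likLaw b) =
      ∫⁻ z, ((W.w a z.1 : ℝ≥0∞) * W.w b z.2) * F (W.lik z.1, W.lik z.2) ∂W.μ.prod W.μ := by
  have ha := (W.measurable_w a).coe_nnreal_ennreal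
  have hb := (W.measurable_w b).coe_nnreal_ennreal
  have hl := W.measurable_lik.prodMap W.measurable_lik
  rw [likLaw, likLaw, Measure.map_prod_map _ _ W.measurable_lik W.measurable_lik,
    lintegral_map hF hl, law, law, prod_withDensity ha hb]
  exact lintegral_withDensity_eq_lintegral_mul _
    ((ha.comp measurable_fst).mul (hb.comp measurable_snd)) (hF.comp hl)

/-- Channel symmetry in terms of likelihoods: flipping the input swaps, in law, the two likelihoods.
-/
theorem likLaw_add (x b : ZMod 2) : W.likLaw (x + b) = (W.likLaw x).map (shiftLik b) := by
  have h1 : W.likLaw (x + 1) = (W.likLaw x).map (shiftLik 1) := by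
    obtain ⟨π, hπ, -, hs⟩ := W.symmetric
    refine Measure.ext_of_lintegral _ fun F hF => ?_
    have hF' : Measurable fun p => F (shiftLik 1 p) := hF.comp (measurable_shiftLik 1)
    have h := hπ.lintegral_comp
      ((W.measurable_w x).coe_nnreal_ennreal.mul (hF'.comp W.measurable_lik))
    rw [lintegral_map hF (measurable_shiftLik 1), lintegral_likLaw _ _ hF,
      lintegral_likLaw _ _ hF']
    refine Eq.trans ?_ h
    refine lintegral_congr fun y => ?_
    simp only [Pi.mul_apply, Function.comp_apply]
    rw [hs]
    congr 2
    funext u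
    simp only [shiftLik, lik, hs, add_assoc, CharTwo.add_self_eq_zero, add_zero]
  have h0 : W.likLaw (x + 0) = (W.likLaw x).map (shiftLik 0) := by
    have : shiftLik 0 = id := by funext p u; simp [shiftLik]
    rw [this, Measure.map_id, add_zero]
  have hb : b = 0 ∨ b = 1 := by revert b; decide
  rcases hb with rfl | rfl
  · exact h0
  · exact h1

theorem map_minusLik_eq (c b b' : ZMod 2) :
    ((W.likLaw (c + b)).prod (W.likLaw b)).map minusLik =
      ((W.likLaw (c + b')).prod (W.likLaw b')).map minusLik := by
  have key : ∀ b, ((W.likLaw (c + b)).prod (W.likLaw b)).map minusLik =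
      ((W.likLaw c).prod (W.likLaw 0)).map minusLik := by
    intro b
    have h := measurable_shiftLik b
    have h0 := W.likLaw_add 0 b
    rw [zero_add] at h0
    rw [h0, likLaw_add, Measure.map_prod_map _ _ h h, Measure.map_map measurable_minusLik
      (h.prodMap h)]
    congr 1
    funext p
    exact minusLik_shift b p
  rw [key, key]

/-- `W⁻` averages over a uniform second input, whereas in the scheme that input is a symbol of a
given codeword. By symmetry every `b` contributes the same law, so the average equals each of its
terms. -/
theorem likLaw_minus (c b : ZMod 2) :
    W.minus.likLaw c = ((W.likLaw (c + b)).prod (W.likLaw b)).map minusLik := by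
  refine Measure.ext_of_lintegral _ fun F hF => ?_
  have hF' := hF.comp measurable_minusLik
  have hl : Measurable fun z : W.Y × W.Y => (W.lik z.1, W.lik z.2) :=
    W.measurable_lik.prodMap W.measurable_lik
  have hm : ∀ a b : ZMod 2, Measurable fun z : W.Y × W.Y =>
      ((W.w a z.1 : ℝ≥0∞) * W.w b z.2) * F (minusLik (W.lik z.1, W.lik z.2)) := fun a b =>
    (((W.measurable_w a).coe_nnreal_ennreal.comp measurable_fst).mul
      ((W.measurable_w b).coe_nnreal_ennreal.comp measurable_snd)).mul (hF'.comp hl)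
  have hT : ∀ a, ∫⁻ z : W.Y × W.Y, ((W.w (c + a) z.1 : ℝ≥0∞) * W.w a z.2) *
      F (minusLik (W.lik z.1, W.lik z.2)) ∂W.μ.prod W.μ =
        ∫⁻ p, F p ∂((W.likLaw (c + b)).prod (W.likLaw b)).map minusLik := fun a => by
    rw [W.map_minusLik_eq c b a, lintegral_map hF measurable_minusLik]
    exact (W.lintegral_likLaw_prod (c + a) a hF').symm
  rw [lintegral_likLaw _ _ hF]
  have h2 : (2⁻¹ : ℝ≥0∞) + 2⁻¹ = 1 := ENNReal.inv_two_add_inv_two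
  calc _ = ∫⁻ z : W.Y × W.Y, ∑ a : ZMod 2, 2⁻¹ * (((W.w (c + a) z.1 : ℝ≥0∞) * W.w a z.2) *
        F (minusLik (W.lik z.1, W.lik z.2))) ∂W.μ.prod W.μ := by
        refine lintegral_congr fun z => ?_
        simp_rw [← mul_assoc]
        rw [← Finset.sum_mul]
        congr 1
        simp only [minus]
        push_cast
        simp [mul_assoc]
    _ = _ := by
        rw [lintegral_finsetSum _ fun a _ => (hm _ a).const_mul _]
        simp_rw [lintegral_const_mul _ (hm _ _), hT]
        rw [ZMod.sum_univ_two, ← add_mul, h2, one_mul]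

/-- Likewise the first input, uniform in `W⁺`, may be frozen at any `v`: the shift by `v` in
`plusLik` undoes its effect on the first channel use. -/
theorem likLaw_plus (c v : ZMod 2) :
    W.plus.likLaw c = ((W.likLaw (v + c)).prod (W.likLaw c)).map (plusLik v) := by
  have key : ∀ v, ((W.likLaw (v + c)).prod (W.likLaw c)).map (plusLik v) =
      ((W.likLaw c).prod (W.likLaw c)).map (plusLik 0) := by
    intro v
    have h := measurable_shiftLik v
    rw [add_comm v c, likLaw_add, ← Measure.map_id (μ := (W.likLaw c)),
      Measure.map_map h measurable_id, Measure.map_prod_map _ _ (h.comp measurable_id)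
      measurable_id, Measure.map_map (measurable_plusLik v)
      ((h.comp measurable_id).prodMap measurable_id), Measure.map_id]
    congr 1
    funext p
    exact plusLik_shift v p
  refine Measure.ext_of_lintegral _ fun F hF => ?_
  have hF' := fun v => hF.comp (measurable_plusLik v)
  have hl : Measurable fun z : W.Y × W.Y => (W.lik z.1, W.lik z.2) :=
    W.measurable_lik.prodMap W.measurable_lik
  have hT : ∀ a, ∫⁻ z : W.Y × W.Y, ((W.w (a + c) z.1 : ℝ≥0∞) * W.w c z.2) *
      F (plusLik a (W.lik z.1, W.lik z.2)) ∂W.μ.prod W.μ =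
        ∫⁻ p, F p ∂((W.likLaw (v + c)).prod (W.likLaw c)).map (plusLik v) := fun a => by
    rw [key v, ← key a, lintegral_map hF (measurable_plusLik a)]
    exact (W.lintegral_likLaw_prod (a + c) c (hF' a)).symm
  have hm : ∀ a, Measurable fun z : W.Y × W.Y => ((W.w (a + c) z.1 : ℝ≥0∞) * W.w c z.2) *
      F (plusLik a (W.lik z.1, W.lik z.2)) := fun a =>
    (((W.measurable_w _).coe_nnreal_ennreal.comp measurable_fst).mul
      ((W.measurable_w _).coe_nnreal_ennreal.comp measurable_snd)).mul ((hF' a).comp hl)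
  rw [lintegral_likLaw _ _ hF]
  have h2 : (2⁻¹ : ℝ≥0∞) + 2⁻¹ = 1 := ENNReal.inv_two_add_inv_two
  calc _ = ∫⁻ z : (W.Y × W.Y) × ZMod 2, 2⁻¹ * (((W.w (z.2 + c) z.1.1 : ℝ≥0∞) * W.w c z.1.2) *
        F (plusLik z.2 (W.lik z.1.1, W.lik z.1.2))) ∂(W.μ.prod W.μ).prod Measure.count := by
        refine lintegral_congr fun z => ?_
        rw [← mul_assoc]
        congr 1
        simp only [plus]
        push_cast
        simp
    _ = _ := by
        rw [lintegral_prod_symm' _ (measurable_from_prod_countable_left fun a =>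
          (hm a).const_mul _), lintegral_count, tsum_fintype]
        simp_rw [lintegral_const_mul _ (hm _), hT]
        rw [ZMod.sum_univ_two, ← add_mul, h2, one_mul]

end BMS

/-! ### Decoding from the likelihoods -/

/-- Maximum-likelihood decoding of a linear code, from the likelihoods. -/
def likMlDecode {k n : ℕ} (G : Matrix (Fin k) (Fin n) (ZMod 2)) (p : Fin n → ZMod 2 → ℝ≥0) :
    Fin k → ZMod 2 :=
  ((Finset.univ : Finset (Fin k → ZMod 2)).toList.argmax
    fun m => ∏ t, (p t ((m ᵥ* G) t) : ℝ)).getD 0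

/-- Successive decoding from the likelihoods. -/
def likScDecode : (l : ℕ) → {n : ℕ} → {k : SubIdx l → ℕ} → OuterCodes l n k →
    (SubIdx l → Fin n → ZMod 2 → ℝ≥0) → Messages l k
  | 0, _, _, G, p => fun s => likMlDecode (G s) (p s)
  | l + 1, n, k, G, p =>
    let m₁ : Messages l (fun s => k (Sum.inl s)) := likScDecode l (fun s => G (Sum.inl s))
      fun s t => minusLik (p (Sum.inl s) t, p (Sum.inr s) t)
    let v : SubIdx l → Fin n → ZMod 2 := concatEncode (fun s => G (Sum.inl s)) m₁
    let m₂ : Messages l (fun s => k (Sum.inr s)) := likScDecode l (fun s => G (Sum.inr s))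
      fun s t => plusLik (v s t) (p (Sum.inl s) t, p (Sum.inr s) t)
    fun s => Sum.rec (motive := fun s => Fin (k s) → ZMod 2) m₁ m₂ s

/-- The decoder uses outputs only through their likelihoods. The growing alphabets of the
sub-channels are thereby replaced by one fixed space. -/
theorem scDecode_eq (l : ℕ) (W : BMS.{u}) {n : ℕ} {k : SubIdx l → ℕ} (G : OuterCodes l n k)
    (y : SubIdx l → Fin n → W.Y) :
    scDecode l W G y = likScDecode l G fun s t => W.lik (y s t) := by
  induction l generalizing W with
  | zero => rfl
  | succ l ih =>
    have e : scDecode l W.minus (fun s => G (Sum.inl s))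
        (fun s t => (y (Sum.inl s) t, y (Sum.inr s) t)) =
        likScDecode l (fun s => G (Sum.inl s)) fun s t =>
          minusLik (W.lik (y (Sum.inl s) t), W.lik (y (Sum.inr s) t)) := ih W.minus _ _
    simp only [scDecode, likScDecode]
    rw [e]
    funext s
    rcases s with s | s
    · rfl
    · exact congrFun (ih W.plus _ _) s

/-- Ties count as errors here, so the rule resolving them plays no role. -/
theorem le_of_likMlDecode_ne {k n : ℕ} (G : Matrix (Fin k) (Fin n) (ZMod 2))
    (p : Fin n → ZMod 2 → ℝ≥0) {m : Fin k → ZMod 2} (h : likMlDecode G p ≠ m) :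
    ∃ d ≠ 0, ∏ t, p t ((m ᵥ* G) t) ≤ ∏ t, p t (((m + d) ᵥ* G) t) := by
  refine ⟨likMlDecode G p - m, sub_ne_zero.2 h, ?_⟩
  rw [add_sub_cancel]
  have hm : m ∈ (Finset.univ : Finset (Fin k → ZMod 2)).toList := by simp
  cases e : (Finset.univ : Finset (Fin k → ZMod 2)).toList.argmax
      fun m => ∏ t, (p t ((m ᵥ* G) t) : ℝ) with
  | none =>
    rw [List.argmax_eq_none] at e
    rw [e] at hm
    simp at hm
  | some m' =>
    have : likMlDecode G p = m' := by rw [likMlDecode, e]; rfl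
    rw [this]
    have := List.le_of_mem_argmax hm (Option.mem_def.2 e)
    exact_mod_cast this

/-! ### The union bound for successive decoding -/

namespace BMS

/-- The sub-channel with index `s` after `l` polarization steps. -/
def sub : (l : ℕ) → BMS.{u} → SubIdx l → BMS.{u}
  | 0, W, _ => W
  | l + 1, W, s => Sum.elim (sub l W.minus) (sub l W.plus) s

/-- The probability that, when the zero message is encoded by the linear code with generator matrix
`G` and sent over `W`, some other message is at least as likely. -/
def confusion (W : BMS.{u}) {k n : ℕ} (G : Matrix (Fin k) (Fin n) (ZMod 2)) : ℝ≥0∞ :=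
  (Measure.pi fun _ : Fin n => W.likLaw 0)
    {p | ∃ d ≠ 0, ∏ t, p t 0 ≤ ∏ t, p t ((d ᵥ* G) t)}

variable (W : BMS.{u})

/-- Shifting the likelihoods by the transmitted codeword turns it into the zero word, by symmetry
and linearity. -/
theorem likMlDecode_error_le {k n : ℕ} (G : Matrix (Fin k) (Fin n) (ZMod 2))
    (m : Fin k → ZMod 2) :
    (Measure.pi fun t => W.likLaw ((m ᵥ* G) t)) {p | likMlDecode G p ≠ m} ≤ W.confusion G := by
  have hmp : MeasurePreserving (fun (p : Fin n → ZMod 2 → ℝ≥0) t => shiftLik ((m ᵥ* G) t) (p t))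
      (Measure.pi fun _ => W.likLaw 0) (Measure.pi fun t => W.likLaw ((m ᵥ* G) t)) := by
    refine measurePreserving_pi _ _ fun t => ⟨measurable_shiftLik _, ?_⟩
    rw [← likLaw_add, zero_add]
  have hmeas : MeasurableSet {p : Fin n → ZMod 2 → ℝ≥0 |
      ∃ d ≠ 0, ∏ t, p t ((m ᵥ* G) t) ≤ ∏ t, p t (((m + d) ᵥ* G) t)} := by
    have : {p : Fin n → ZMod 2 → ℝ≥0 |
        ∃ d ≠ 0, ∏ t, p t ((m ᵥ* G) t) ≤ ∏ t, p t (((m + d) ᵥ* G) t)} =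
        ⋃ d : {d : Fin k → ZMod 2 // d ≠ 0},
          {p | ∏ t, p t ((m ᵥ* G) t) ≤ ∏ t, p t (((m + d.1) ᵥ* G) t)} := by
      ext p; simp
    rw [this]
    refine MeasurableSet.iUnion fun d => measurableSet_le ?_ ?_ <;> fun_prop
  have hsub : {p | likMlDecode G p ≠ m} ⊆
      {p | ∃ d ≠ 0, ∏ t, p t ((m ᵥ* G) t) ≤ ∏ t, p t (((m + d) ᵥ* G) t)} :=
    fun p hp => le_of_likMlDecode_ne G p hp
  refine (measure_mono hsub).trans ?_
  rw [← hmp.measure_preimage hmeas.nullMeasurableSet]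
  refine measure_mono fun p ⟨d, hd, h⟩ => ⟨d, hd, ?_⟩
  simpa only [shiftLik, Matrix.add_vecMul, Pi.add_apply, CharTwo.add_self_eq_zero,
    add_right_comm ((m ᵥ* G) _), zero_add] using h

end BMS

theorem MeasureTheory.measurePreserving_pi_pi_pair {ι κ X X' : Type*} [Fintype ι] [Fintype κ]
    [MeasurableSpace X] [MeasurableSpace X'] (ν₁ ν₂ : ι → κ → Measure X)
    [∀ s t, IsProbabilityMeasure (ν₁ s t)] [∀ s t, IsProbabilityMeasure (ν₂ s t)]
    (g : ι → κ → X × X → X') (hg : ∀ s t, Measurable (g s t)) :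
    MeasurePreserving
      (fun (p : ι ⊕ ι → κ → X) s t => g s t (p (Sum.inl s) t, p (Sum.inr s) t))
      (Measure.pi fun s => Measure.pi fun t => Sum.elim ν₁ ν₂ s t)
      (Measure.pi fun s => Measure.pi fun t => ((ν₁ s t).prod (ν₂ s t)).map (g s t)) := by
  have hprob : ∀ s t, IsProbabilityMeasure (Sum.elim ν₁ ν₂ s t) := by
    rintro (s | s) t <;> simp only [Sum.elim_inl, Sum.elim_inr] <;> infer_instance
  have hprob' : ∀ s t, IsProbabilityMeasure (((ν₁ s t).prod (ν₂ s t)).map (g s t)) :=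
    fun s t => Measure.isProbabilityMeasure_map (hg s t).aemeasurable
  have h1 := measurePreserving_sumPiEquivProdPi (X := fun _ : ι ⊕ ι => κ → X)
    fun s => Measure.pi fun t => Sum.elim ν₁ ν₂ s t
  have h2 := (measurePreserving_arrowProdEquivProdArrow (κ → X) (κ → X) ι
    (fun s => Measure.pi (ν₁ s)) fun s => Measure.pi (ν₂ s)).symm
  have h3 := measurePreserving_pi
    (fun s => (Measure.pi (ν₁ s)).prod (Measure.pi (ν₂ s)))
    (fun s => Measure.pi fun t => ((ν₁ s t).prod (ν₂ s t)).map (g s t)) fun s =>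
    (measurePreserving_pi (fun t => (ν₁ s t).prod (ν₂ s t)) _
      fun t => ⟨hg s t, rfl⟩).comp
      (measurePreserving_arrowProdEquivProdArrow X X κ (ν₁ s) (ν₂ s)).symm
  exact (h3.comp h2).comp h1

namespace BMS

/-- If both stages succeed when the second is given the true feedback `c₁`, the actual decoder
succeeds. The union bound needs no independence between the stages. -/
theorem likScDecode_error_le (l : ℕ) (W : BMS.{u}) {n : ℕ} {k : SubIdx l → ℕ}
    (G : OuterCodes l n k) (m : Messages l k) :
    (Measure.pi fun s => Measure.pi fun t => W.likLaw (concatEncode G m s t))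
      {p | likScDecode l G p ≠ m} ≤ ∑ s, (sub l W s).confusion (G s) := by
  induction l generalizing W with
  | zero =>
    have hsub : {p | likScDecode 0 G p ≠ m} ⊆
        ⋃ s, (Function.eval s) ⁻¹' {p | likMlDecode (G s) p ≠ m s} := by
      intro p hp
      by_contra hc
      simp only [mem_iUnion, mem_preimage, mem_ofPred_eq, not_exists, not_not] at hc
      exact hp (funext hc)
    refine (measure_mono hsub).trans ((measure_iUnion_fintype_le _ _).trans
      (Finset.sum_le_sum fun s _ => ?_))
    have hmp := measurePreserving_eval
      (fun s => Measure.pi fun t => W.likLaw (concatEncode G m s t)) s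
    -- This inequality holds for arbitrary sets, so measurability of the decoding event is not
    -- needed.
    refine (Measure.le_map_apply hmp.measurable.aemeasurable _).trans ?_
    rw [hmp.map_eq]
    exact W.likMlDecode_error_le (G s) (m s)
  | succ l ih =>
    set G₁ : OuterCodes l n fun s => k (Sum.inl s) := fun s => G (Sum.inl s) with hG₁
    set G₂ : OuterCodes l n fun s => k (Sum.inr s) := fun s => G (Sum.inr s) with hG₂
    set m₁ : Messages l fun s => k (Sum.inl s) := fun s => m (Sum.inl s) with hm₁
    set m₂ : Messages l fun s => k (Sum.inr s) := fun s => m (Sum.inr s) with hm₂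
    set c₁ := concatEncode G₁ m₁ with hc₁
    set c₂ := concatEncode G₂ m₂ with hc₂
    have hlaw : (Measure.pi fun s => Measure.pi fun t => W.likLaw (concatEncode G m s t)) =
        Measure.pi fun s : SubIdx l ⊕ SubIdx l => Measure.pi fun t =>
          Sum.elim (fun s t => W.likLaw (c₁ s t + c₂ s t)) (fun s t => W.likLaw (c₂ s t)) s t := by
      refine congrArg Measure.pi (funext fun s => congrArg Measure.pi (funext fun t => ?_))
      rcases s with s | s <;> rfl
    have hminus := measurePreserving_pi_pi_pair (fun s t => W.likLaw (c₁ s t + c₂ s t))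
      (fun s t => W.likLaw (c₂ s t)) (fun _ _ => minusLik) fun _ _ => measurable_minusLik
    have hplus := measurePreserving_pi_pi_pair (fun s t => W.likLaw (c₁ s t + c₂ s t))
      (fun s t => W.likLaw (c₂ s t)) (fun s t => plusLik (c₁ s t)) fun _ _ => measurable_plusLik _
    simp_rw [← likLaw_minus] at hminus
    simp_rw [← likLaw_plus] at hplus
    set f₁ : (SubIdx l ⊕ SubIdx l → Fin n → ZMod 2 → ℝ≥0) → SubIdx l → Fin n → ZMod 2 → ℝ≥0 :=
      fun p s t => minusLik (p (Sum.inl s) t, p (Sum.inr s) t) with hf₁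
    set f₂ : (SubIdx l ⊕ SubIdx l → Fin n → ZMod 2 → ℝ≥0) → SubIdx l → Fin n → ZMod 2 → ℝ≥0 :=
      fun p s t => plusLik (c₁ s t) (p (Sum.inl s) t, p (Sum.inr s) t) with hf₂
    have hsub : {p | likScDecode (l + 1) G p ≠ m} ⊆
        f₁ ⁻¹' {p | likScDecode l G₁ p ≠ m₁} ∪ f₂ ⁻¹' {p | likScDecode l G₂ p ≠ m₂} := by
      intro p hp
      by_contra hc
      have h1 : likScDecode l G₁ (f₁ p) = m₁ := by
        by_contra h
        exact hc (Or.inl h)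
      have h2 : likScDecode l G₂ (f₂ p) = m₂ := by
        by_contra h
        exact hc (Or.inr h)
      refine hp (funext fun s => ?_)
      rcases s with s | s
      · exact congrFun h1 s
      · refine Eq.trans ?_ (congrFun h2 s)
        have h3 : likScDecode l G₂ (fun s t => plusLik (concatEncode G₁ (likScDecode l G₁ (f₁ p)) s t)
          (p (Sum.inl s) t, p (Sum.inr s) t)) = likScDecode l G₂ (f₂ p) := by rw [h1]
        exact congrFun h3 s
    rw [hlaw]
    refine (measure_mono hsub).trans ((measure_union_le _ _).trans ?_)
    refine (add_le_add ((Measure.le_map_apply hminus.measurable.aemeasurable _).trans ?_)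
      ((Measure.le_map_apply hplus.measurable.aemeasurable _).trans ?_)).trans
      (Fintype.sum_sum_type fun s : SubIdx l ⊕ SubIdx l =>
        (sub (l + 1) W s).confusion (G s)).symm.le
    · rw [hminus.map_eq]
      exact ih W.minus G₁ m₁
    · rw [hplus.map_eq]
      exact ih W.plus G₂ m₂

theorem outputLaw_error_le (W : BMS.{u}) {l n : ℕ} {k : SubIdx l → ℕ}
    (G : OuterCodes l n k) (m : Messages l k) :
    outputLaw W (concatEncode G m) {y | scDecode l W G y ≠ m} ≤
      ∑ s, (sub l W s).confusion (G s) := by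
  have hmp : MeasurePreserving (fun (y : SubIdx l → Fin n → W.Y) s t => W.lik (y s t))
      (outputLaw W (concatEncode G m))
      (Measure.pi fun s => Measure.pi fun t => W.likLaw (concatEncode G m s t)) :=
    measurePreserving_pi _ _ fun s => measurePreserving_pi _ _ fun t => ⟨W.measurable_lik, rfl⟩
  simp_rw [scDecode_eq]
  refine (Measure.le_map_apply hmp.measurable.aemeasurable
    {p | likScDecode l G p ≠ m}).trans ?_
  rw [hmp.map_eq]
  exact likScDecode_error_le l W G m

theorem confusion_le_one (W : BMS.{u}) {k n : ℕ} (G : Matrix (Fin k) (Fin n) (ZMod 2)) :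
    W.confusion G ≤ 1 := prob_le_one

theorem errorProb_le (W : BMS.{u}) {l n : ℕ} {k : SubIdx l → ℕ} (G : OuterCodes l n k) :
    errorProb W G ≤ ∑ s, ((sub l W s).confusion (G s)).toReal := by
  have hfin : ∀ s, (sub l W s).confusion (G s) ≠ ⊤ := fun s =>
    ((confusion_le_one _ _).trans_lt ENNReal.one_lt_top).ne
  rw [errorProb, div_le_iff₀ (by exact_mod_cast Fintype.card_pos)]
  calc _ ≤ ∑ _m : Messages l k, ∑ s, ((sub l W s).confusion (G s)).toReal := by
        refine Finset.sum_le_sum fun m _ => ?_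
        rw [← ENNReal.toReal_sum fun s _ => hfin s]
        exact ENNReal.toReal_mono (ENNReal.sum_ne_top.2 fun s _ => hfin s)
          (outputLaw_error_le W G m)
    _ = _ := by rw [Finset.sum_const, nsmul_eq_mul, mul_comm, Finset.card_univ]

end BMS

/-! ### Random linear codes -/

/-- The codeword of a nonzero message is uniform over random generator matrices: changing row `i`,
where `d i = 1`, translates it by any word `x`. -/
theorem sum_vecMul_eq {k n : ℕ} {d : Fin k → ZMod 2} (hd : d ≠ 0)
    (f : (Fin n → ZMod 2) → ℝ≥0) :
    2 ^ n * ∑ G : Matrix (Fin k) (Fin n) (ZMod 2), f (d ᵥ* G) =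
      Fintype.card (Matrix (Fin k) (Fin n) (ZMod 2)) * ∑ x, f x := by
  obtain ⟨i, hi⟩ := Function.ne_iff.1 hd
  have hi1 : d i = 1 := by
    have : ∀ a : ZMod 2, a ≠ 0 → a = 1 := by decide
    exact this _ hi
  set G₀ : (Fin n → ZMod 2) → Matrix (Fin k) (Fin n) (ZMod 2) :=
    fun x => Matrix.of fun j t => if j = i then x t else 0 with hG₀
  have h0 : ∀ x, d ᵥ* G₀ x = x := fun x => by
    funext t
    simp [hG₀, Matrix.vecMul, dotProduct, hi1]
  have h1 : ∀ x, ∑ G : Matrix (Fin k) (Fin n) (ZMod 2), f (d ᵥ* G) =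
      ∑ G : Matrix (Fin k) (Fin n) (ZMod 2), f (d ᵥ* G + x) := fun x => by
    refine (Fintype.sum_equiv (Equiv.addRight (G₀ x)) _ _ fun G => ?_).symm
    simp [Matrix.vecMul_add, h0]
  have h2 : ∀ y : Fin n → ZMod 2, ∑ x, f (y + x) = ∑ x, f x := fun y =>
    Fintype.sum_equiv (Equiv.addLeft y) _ _ fun x => rfl
  calc _ = ∑ x : Fin n → ZMod 2, ∑ G : Matrix (Fin k) (Fin n) (ZMod 2), f (d ᵥ* G + x) := by
        simp_rw [← h1]
        simp
    _ = _ := by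
        rw [Finset.sum_comm]
        simp_rw [h2]
        simp

theorem sum_prod_vecMul_eq {k n : ℕ} {d : Fin k → ZMod 2} (hd : d ≠ 0)
    (g : Fin n → ZMod 2 → ℝ≥0) :
    ∑ G : Matrix (Fin k) (Fin n) (ZMod 2), ∏ t, g t ((d ᵥ* G) t) =
      Fintype.card (Matrix (Fin k) (Fin n) (ZMod 2)) * ∏ t, 2⁻¹ * (g t 0 + g t 1) := by
  have h := sum_vecMul_eq (k := k) hd fun x => ∏ t, g t (x t)
  have h2 : ∑ x : Fin n → ZMod 2, ∏ t, g t (x t) = ∏ t, (g t 0 + g t 1) := by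
    have := Finset.prod_univ_sum (fun _ : Fin n => (Finset.univ : Finset (ZMod 2))) g
    rw [Fintype.piFinset_univ] at this
    rw [← this]
    exact Finset.prod_congr rfl fun t _ => ZMod.sum_univ_two _
  rw [h2] at h
  rw [Finset.prod_mul_distrib, Finset.prod_const, Finset.card_univ, Fintype.card_fin,
    mul_left_comm, ← h, ← mul_assoc, ← mul_pow]
  simp

theorem sum_ne_zero_prod_vecMul_le {k n : ℕ} (g : Fin n → ZMod 2 → ℝ≥0) :
    ∑ G : Matrix (Fin k) (Fin n) (ZMod 2), ∑ d : {d : Fin k → ZMod 2 // d ≠ 0},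
      ∏ t, g t ((d.1 ᵥ* G) t) ≤
        Fintype.card (Matrix (Fin k) (Fin n) (ZMod 2)) *
          (2 ^ k * ∏ t, 2⁻¹ * (g t 0 + g t 1)) := by
  rw [Finset.sum_comm]
  simp_rw [fun d : {d : Fin k → ZMod 2 // d ≠ 0} => sum_prod_vecMul_eq d.2 g]
  rw [Finset.sum_const, nsmul_eq_mul, mul_left_comm]
  refine mul_le_mul_right (mul_le_mul_left ?_ _) _
  have h1 := Fintype.card_subtype_le fun d : Fin k → ZMod 2 => d ≠ 0
  have h2 : Fintype.card (Fin k → ZMod 2) = 2 ^ k := by simp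
  rw [h2] at h1
  rw [Finset.card_univ]
  exact_mod_cast h1

/-- Jensen's inequality for the concave function `x ↦ x ^ ρ`. -/
theorem NNReal.sum_rpow_le_card_mul {ι : Type*} [Fintype ι] [Nonempty ι] (X : ι → ℝ≥0) {ρ : ℝ}
    (h0 : 0 ≤ ρ) (h1 : ρ ≤ 1) {B : ℝ≥0} (hB : ∑ i, X i ≤ Fintype.card ι * B) :
    ∑ i, X i ^ ρ ≤ Fintype.card ι * B ^ ρ := by
  have hc : (Fintype.card ι : ℝ≥0) ≠ 0 := by exact_mod_cast Fintype.card_ne_zero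
  rcases h0.eq_or_lt with rfl | h0
  · simp
  have hw : ∑ _i : ι, (Fintype.card ι : ℝ≥0)⁻¹ = 1 := by simp [hc]
  have h := NNReal.rpow_arith_mean_le_arith_mean_rpow Finset.univ
    (fun _ => (Fintype.card ι : ℝ≥0)⁻¹) (fun i => X i ^ ρ) hw (p := 1 / ρ)
    ((one_le_div h0).2 h1)
  simp_rw [← NNReal.rpow_mul, mul_one_div_cancel h0.ne', NNReal.rpow_one, ← Finset.mul_sum] at h
  have h3 : (Fintype.card ι : ℝ≥0)⁻¹ * ∑ i, X i ≤ B := by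
    rw [inv_mul_le_iff₀ (pos_iff_ne_zero.2 hc)]; exact hB
  have h4 := NNReal.rpow_le_rpow (h.trans h3) h0.le
  rw [← NNReal.rpow_mul, one_div_mul_cancel h0.ne', NNReal.rpow_one,
    inv_mul_le_iff₀ (pos_iff_ne_zero.2 hc)] at h4
  exact h4

theorem MeasureTheory.lintegral_pi_prod {ι X : Type*} [Fintype ι] [MeasurableSpace X]
    (ν : ι → Measure X) [∀ i, IsProbabilityMeasure (ν i)] {K : ι → X → ℝ≥0∞}
    (hK : ∀ i, Measurable (K i)) :
    ∫⁻ p, ∏ i, K i (p i) ∂Measure.pi ν = ∏ i, ∫⁻ x, K i x ∂ν i := by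
  rw [ProbabilityTheory.lintegral_prod_eq_prod_lintegral_of_indepFun Finset.univ
    (fun i (p : ι → X) => K i (p i))
    (ProbabilityTheory.iIndepFun_pi fun i => (hK i).aemeasurable)
    fun i => (hK i).comp (measurable_pi_apply i)]
  exact Finset.prod_congr rfl fun i _ => (measurePreserving_eval ν i).lintegral_comp (hK i)

theorem one_le_prod_rpow {n : ℕ} {p : Fin n → ZMod 2 → ℝ≥0} (h0 : ∀ t, p t 0 ≠ 0)
    {x : Fin n → ZMod 2} (h : ∏ t, p t 0 ≤ ∏ t, p t (x t)) {a : ℝ} (ha : 0 ≤ a) :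
    1 ≤ ∏ t, (p t (x t) / p t 0) ^ a := by
  rw [NNReal.finsetProd_rpow, Finset.prod_div_distrib]
  refine NNReal.one_le_rpow ?_ ha
  rw [one_le_div₀ (Finset.prod_pos fun t _ => pos_iff_ne_zero.2 (h0 t))]
  exact h

namespace BMS

variable (W : BMS.{u})

theorem ae_likLaw_zero : ∀ᵐ p ∂W.likLaw 0, p 0 ≠ 0 := by
  have hm : MeasurableSet {p : ZMod 2 → ℝ≥0 | p 0 ≠ 0} := by
    simp_rw [← pos_iff_ne_zero]
    exact measurableSet_lt measurable_const (measurable_pi_apply 0)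
  rw [likLaw, ae_map_iff W.measurable_lik.aemeasurable hm, law,
    ae_withDensity_iff (W.measurable_w 0).coe_nnreal_ennreal]
  refine Eventually.of_forall fun y h => ?_
  simpa [lik] using h

theorem ae_pi_likLaw_zero (n : ℕ) :
    ∀ᵐ p ∂Measure.pi fun _ : Fin n => W.likLaw 0, ∀ t, p t 0 ≠ 0 := by
  refine ae_all_iff.2 fun t => ?_
  exact (measurePreserving_eval (fun _ : Fin n => W.likLaw 0) t).quasiMeasurePreserving.ae
    W.ae_likLaw_zero

/-! #### The random-coding bound -/

/-- Gallager's bound: on the confusion event some product of likelihood ratios is at least `1`,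
hence so is the `ρ`-th power of the sum. -/
theorem confusion_le_lintegral {k n : ℕ} (G : Matrix (Fin k) (Fin n) (ZMod 2)) {s ρ : ℝ}
    (hs : 0 ≤ s) (hρ : 0 ≤ ρ) :
    W.confusion G ≤ ∫⁻ p, (((∑ d : {d : Fin k → ZMod 2 // d ≠ 0},
      ∏ t, (p t ((d.1 ᵥ* G) t) / p t 0) ^ s) ^ ρ : ℝ≥0) : ℝ≥0∞)
        ∂Measure.pi fun _ : Fin n => W.likLaw 0 := by
  set S := {p : Fin n → ZMod 2 → ℝ≥0 | ∃ d ≠ 0, ∏ t, p t 0 ≤ ∏ t, p t ((d ᵥ* G) t)} with hS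
  -- Zero likelihoods of the input sent form a null set; there the ratios would be divisions by
  -- zero.
  have h1 : W.confusion G ≤ (Measure.pi fun _ : Fin n => W.likLaw 0)
      (S ∩ {p | ∀ t, p t 0 ≠ 0}) := by
    refine measure_mono_ae ?_
    filter_upwards [W.ae_pi_likLaw_zero n] with p hp hq
    exact ⟨hq, hp⟩
  refine h1.trans (meas_le_lintegral₀ ?_ ?_)
  · refine Measurable.aemeasurable ?_
    fun_prop
  · rintro p ⟨⟨d, hd, h⟩, hp⟩
    have h2 := one_le_prod_rpow hp h hs
    have h3 := Finset.single_le_sum (s := Finset.univ)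
      (f := fun d : {d : Fin k → ZMod 2 // d ≠ 0} => ∏ t, (p t ((d.1 ᵥ* G) t) / p t 0) ^ s)
      (fun _ _ => zero_le) (Finset.mem_univ ⟨d, hd⟩)
    exact ENNReal.one_le_coe_iff.2 (NNReal.one_le_rpow (h2.trans h3) hρ)

/-- Since `s (1 + ρ) = 1`, weighting by `w 0` leaves `w 0 ^ s * H` with `H` symmetric in the inputs.
Symmetry allows averaging with `w 1 ^ s * H`, which completes the power `1 + ρ`. -/
theorem lintegral_gallager {ρ : ℝ} (hρ : 0 ≤ ρ) :
    ∫⁻ p, (((2⁻¹ * ((p 0 / p 0) ^ (1 / (1 + ρ)) + (p 1 / p 0) ^ (1 / (1 + ρ)))) ^ ρ : ℝ≥0) : ℝ≥0∞)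
      ∂W.likLaw 0 = ENNReal.ofReal (W.gallagerInt ρ) := by
  have hρ1 : 0 < 1 + ρ := by linarith
  set s := 1 / (1 + ρ) with hs_def
  have hs0 : 0 < s := by positivity
  have hs : s * (1 + ρ) = 1 := by rw [hs_def]; field_simp
  have hm : Measurable fun p : ZMod 2 → ℝ≥0 =>
      (((2⁻¹ * ((p 0 / p 0) ^ s + (p 1 / p 0) ^ s)) ^ ρ : ℝ≥0) : ℝ≥0∞) := by fun_prop
  set H : W.Y → ℝ≥0 := fun y => (2⁻¹ * (W.w 0 y ^ s + W.w 1 y ^ s)) ^ ρ with hH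
  have hw := W.measurable_w
  have hw0 := hw 0
  have hw1 := hw 1
  have hHm : Measurable H := by fun_prop
  have h0 : ∀ y, (W.w 0 y : ℝ≥0∞) * (((2⁻¹ * ((W.lik y 0 / W.lik y 0) ^ s +
      (W.lik y 1 / W.lik y 0) ^ s)) ^ ρ : ℝ≥0) : ℝ≥0∞) = ((W.w 0 y ^ s * H y : ℝ≥0) : ℝ≥0∞) := by
    intro y
    rw [← ENNReal.coe_mul]
    congr 1
    simp only [lik, hH]
    by_cases h : W.w 0 y = 0
    · simp [h, NNReal.zero_rpow hs0.ne']
    have e1 : W.w 0 y = W.w 0 y ^ s * W.w 0 y ^ (s * ρ) := by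
      rw [← NNReal.rpow_add h, ← mul_one_add, hs, NNReal.rpow_one]
    have h' : W.w 0 y ^ s ≠ 0 := by simp [NNReal.rpow_eq_zero_iff, h]
    rw [← mul_div_cancel₀ (W.w 0 y ^ s + W.w 1 y ^ s) h', ← mul_div_assoc, mul_div_assoc,
      add_div, ← NNReal.div_rpow, ← NNReal.div_rpow, mul_left_comm, NNReal.mul_rpow (x := _ ^ s),
      ← NNReal.rpow_mul, ← mul_assoc, ← e1]
  have hsym : ∫⁻ y, ((W.w 0 y ^ s * H y : ℝ≥0) : ℝ≥0∞) ∂W.μ =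
      ∫⁻ y, ((W.w 1 y ^ s * H y : ℝ≥0) : ℝ≥0∞) ∂W.μ := by
    obtain ⟨π, hπ, -, hsπ⟩ := W.symmetric
    have hm' : Measurable fun y => ((W.w 0 y ^ s * H y : ℝ≥0) : ℝ≥0∞) := by fun_prop
    rw [← hπ.lintegral_comp hm']
    refine lintegral_congr fun y => ?_
    simp only [hH, hsπ, zero_add, show (1 : ZMod 2) + 1 = 0 by decide]
    rw [add_comm (W.w 1 y ^ s)]
  rw [lintegral_likLaw _ _ hm]
  simp_rw [h0]
  have hsum : ∫⁻ y, ((W.w 0 y ^ s * H y : ℝ≥0) : ℝ≥0∞) ∂W.μ =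
      ∫⁻ y, (((2⁻¹ * (W.w 0 y ^ s + W.w 1 y ^ s)) ^ (1 + ρ) : ℝ≥0) : ℝ≥0∞) ∂W.μ := by
    have e : ∀ y, (((2⁻¹ * (W.w 0 y ^ s + W.w 1 y ^ s)) ^ (1 + ρ) : ℝ≥0) : ℝ≥0∞) =
        2⁻¹ * (((W.w 0 y ^ s * H y : ℝ≥0) : ℝ≥0∞) + ((W.w 1 y ^ s * H y : ℝ≥0) : ℝ≥0∞)) := by
      intro y
      have h2 : (2⁻¹ : ℝ≥0∞) = ((2⁻¹ : ℝ≥0) : ℝ≥0∞) := by simp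
      rw [NNReal.rpow_add_of_nonneg _ zero_le_one hρ, NNReal.rpow_one, h2, ← ENNReal.coe_add,
        ← ENNReal.coe_mul, ← add_mul, ← mul_assoc]
    simp_rw [e]
    rw [lintegral_const_mul' _ _ (by simp), lintegral_add_left (by fun_prop), ← hsym, ← two_mul,
      ← mul_assoc, ENNReal.inv_mul_cancel two_ne_zero ENNReal.ofNat_ne_top, one_mul]
  have hint := W.gallagerInt_eq hρ
  -- Otherwise the Bochner integral would have the default value `0`, but it is positive.
  have hI : Integrable (fun y => ((1 / 2 : ℝ) * ((W.w 0 y : ℝ) ^ (1 / (1 + ρ)) +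
      (W.w 1 y : ℝ) ^ (1 / (1 + ρ)))) ^ (1 + ρ)) W.μ := by
    by_contra hc
    rw [integral_undef hc] at hint
    exact (W.gallagerInt_pos hρ).ne' hint
  rw [hsum, hint, ofReal_integral_eq_lintegral_ofReal hI
    (Eventually.of_forall fun y => by simp only [Pi.zero_apply]; positivity)]
  refine lintegral_congr fun y => ?_
  rw [← ENNReal.ofReal_coe_nnreal]
  congr 1
  push_cast
  rw [one_div, hs_def]

/-- Jensen's inequality for `x ↦ x ^ ρ` is applied to the average over codes at fixed likelihoods;
the result is a product over the channel uses. -/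
theorem sum_confusion_le {k n : ℕ} {ρ : ℝ} (hρ : ρ ∈ Icc (0 : ℝ) 1) :
    ∑ G : Matrix (Fin k) (Fin n) (ZMod 2), W.confusion G ≤
      ENNReal.ofReal (Fintype.card (Matrix (Fin k) (Fin n) (ZMod 2)) *
        ((2 ^ k) ^ ρ * W.gallagerInt ρ ^ n)) := by
  obtain ⟨h0, h1⟩ := hρ
  have hs : 0 ≤ 1 / (1 + ρ) := by positivity
  set s := 1 / (1 + ρ) with hs_def
  set C := Fintype.card (Matrix (Fin k) (Fin n) (ZMod 2)) with hC
  have hpt : ∀ p : Fin n → ZMod 2 → ℝ≥0, ∑ G : Matrix (Fin k) (Fin n) (ZMod 2),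
      (∑ d : {d : Fin k → ZMod 2 // d ≠ 0}, ∏ t, (p t ((d.1 ᵥ* G) t) / p t 0) ^ s) ^ ρ ≤
      C * ((2 ^ k) ^ ρ * ∏ t, (2⁻¹ * ((p t 0 / p t 0) ^ s + (p t 1 / p t 0) ^ s)) ^ ρ) := by
    intro p
    have := NNReal.sum_rpow_le_card_mul _ h0 h1
      (sum_ne_zero_prod_vecMul_le (k := k) fun t b => (p t b / p t 0) ^ s)
    rwa [NNReal.mul_rpow, ← NNReal.finsetProd_rpow] at this
  calc _ ≤ ∑ G : Matrix (Fin k) (Fin n) (ZMod 2), ∫⁻ p,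
        (((∑ d : {d : Fin k → ZMod 2 // d ≠ 0},
          ∏ t, (p t ((d.1 ᵥ* G) t) / p t 0) ^ s) ^ ρ : ℝ≥0) : ℝ≥0∞)
            ∂Measure.pi fun _ : Fin n => W.likLaw 0 :=
        Finset.sum_le_sum fun G _ => W.confusion_le_lintegral G hs h0
    _ = ∫⁻ p, ∑ G : Matrix (Fin k) (Fin n) (ZMod 2), (((∑ d : {d : Fin k → ZMod 2 // d ≠ 0},
          ∏ t, (p t ((d.1 ᵥ* G) t) / p t 0) ^ s) ^ ρ : ℝ≥0) : ℝ≥0∞)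
            ∂Measure.pi fun _ : Fin n => W.likLaw 0 :=
        (lintegral_finsetSum _ fun G _ => by fun_prop).symm
    _ ≤ ∫⁻ p, ((C * (2 ^ k) ^ ρ : ℝ≥0) : ℝ≥0∞) *
          ∏ t, (((2⁻¹ * ((p t 0 / p t 0) ^ s + (p t 1 / p t 0) ^ s)) ^ ρ : ℝ≥0) : ℝ≥0∞)
            ∂Measure.pi fun _ : Fin n => W.likLaw 0 := by
        refine lintegral_mono fun p => ?_
        have := hpt p
        rw [← mul_assoc] at this
        rw [← ENNReal.ofNNReal_finsetSum, ← ENNReal.ofNNReal_finsetProd, ← ENNReal.coe_mul,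
          ENNReal.coe_le_coe]
        exact this
    _ = _ := by
        rw [lintegral_const_mul' _ _ ENNReal.coe_ne_top, lintegral_pi_prod (fun _ => W.likLaw 0)
          (K := fun _ p => (((2⁻¹ * ((p 0 / p 0) ^ s + (p 1 / p 0) ^ s)) ^ ρ : ℝ≥0) : ℝ≥0∞))
          fun _ => by fun_prop]
        rw [W.lintegral_gallager h0, Finset.prod_const, Finset.card_univ, Fintype.card_fin,
          ← mul_assoc, ENNReal.ofReal_mul (by positivity), ENNReal.ofReal_pow
          (W.gallagerInt_pos h0).le, ← ENNReal.ofReal_coe_nnreal]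
        push_cast
        rfl

/-! #### The expurgated bound -/

theorem lintegral_sqrt_ratio :
    ∫⁻ p, (((p 1 / p 0) ^ (1 / 2 : ℝ) : ℝ≥0) : ℝ≥0∞) ∂W.likLaw 0 =
      ENNReal.ofReal W.bhattacharyya := by
  have hm : Measurable fun p : ZMod 2 → ℝ≥0 => (((p 1 / p 0) ^ (1 / 2 : ℝ) : ℝ≥0) : ℝ≥0∞) := by
    fun_prop
  have hI : Integrable (fun y => √((W.w 0 y : ℝ) * W.w 1 y)) W.μ := by
    have hc : Continuous fun p : ℝ => 2 * √(p * (1 - p)) := by fun_prop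
    refine (W.integrable_avg_mul hc).congr (Eventually.of_forall fun y => ?_)
    have ha : (0 : ℝ) ≤ 2 * W.avg y := by positivity
    simp only
    rw [W.w_one_eq, W.w_zero_eq, show 2 * (W.avg y : ℝ) * (1 - W.post y) *
      (2 * W.avg y * W.post y) = (2 * W.avg y) ^ 2 * (W.post y * (1 - W.post y)) by ring,
      Real.sqrt_mul (sq_nonneg _), Real.sqrt_sq ha]
    ring
  rw [lintegral_likLaw _ _ hm, bhattacharyya, ofReal_integral_eq_lintegral_ofReal hI
    (Eventually.of_forall fun y => Real.sqrt_nonneg _)]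
  refine lintegral_congr fun y => ?_
  rw [← ENNReal.coe_mul, ← ENNReal.ofReal_coe_nnreal]
  congr 1
  simp only [lik]
  push_cast
  rw [← Real.sqrt_eq_rpow]
  by_cases h : (W.w 0 y : ℝ) = 0
  · simp [h]
  have h0 : (0 : ℝ) ≤ W.w 0 y := by positivity
  rw [Real.sqrt_div (by positivity), Real.sqrt_mul h0]
  have h1 : √(W.w 0 y : ℝ) ≠ 0 := (Real.sqrt_pos.2 (lt_of_le_of_ne h0 (Ne.symm h))).ne'
  have h2 := Real.mul_self_sqrt h0
  rw [mul_div_assoc', div_eq_iff h1]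
  linear_combination -√(W.w 1 y : ℝ) * h2

/-- The Bhattacharyya coefficient between the outputs of the inputs `0` and `b`. -/
def bhat (b : ZMod 2) : ℝ≥0 := if b = 0 then 1 else W.bhattacharyya.toNNReal

theorem lintegral_ratio_le (b : ZMod 2) :
    ∫⁻ p, (((p b / p 0) ^ (1 / 2 : ℝ) : ℝ≥0) : ℝ≥0∞) ∂W.likLaw 0 ≤ W.bhat b := by
  have hb : b = 0 ∨ b = 1 := by revert b; decide
  rcases hb with rfl | rfl
  · have h1 : ∀ p : ZMod 2 → ℝ≥0, (((p 0 / p 0) ^ (1 / 2 : ℝ) : ℝ≥0) : ℝ≥0∞) ≤ 1 := fun p => by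
      exact_mod_cast NNReal.rpow_le_one (div_self_le_one _) (by norm_num)
    calc _ ≤ ∫⁻ _, 1 ∂W.likLaw 0 := lintegral_mono h1
      _ = _ := by simp [bhat]
  · rw [lintegral_sqrt_ratio]
    exact le_of_eq rfl

theorem confusion_le_sum {k n : ℕ} (G : Matrix (Fin k) (Fin n) (ZMod 2)) :
    W.confusion G ≤ ((∑ d : {d : Fin k → ZMod 2 // d ≠ 0},
      ∏ t, W.bhat ((d.1 ᵥ* G) t) : ℝ≥0) : ℝ≥0∞) := by
  refine (W.confusion_le_lintegral G (s := 1 / 2) (by norm_num) zero_le_one).trans ?_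
  simp_rw [NNReal.rpow_one, ENNReal.ofNNReal_finsetSum, ENNReal.ofNNReal_finsetProd]
  rw [lintegral_finsetSum _ fun d _ => by fun_prop]
  refine Finset.sum_le_sum fun d _ => ?_
  rw [lintegral_pi_prod (fun _ => W.likLaw 0)
    (K := fun t p => (((p ((d.1 ᵥ* G) t) / p 0) ^ (1 / 2 : ℝ) : ℝ≥0) : ℝ≥0∞))
    fun t => by fun_prop]
  exact Finset.prod_le_prod' fun t _ => W.lintegral_ratio_le _

theorem _root_.NNReal.rpow_sum_le_sum_rpow {ι : Type*} (s : Finset ι) (f : ι → ℝ≥0) {a : ℝ}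
    (h0 : 0 < a) (h1 : a ≤ 1) : (∑ i ∈ s, f i) ^ a ≤ ∑ i ∈ s, f i ^ a :=
  Finset.le_sum_of_subadditive (fun x : ℝ≥0 => x ^ a) (NNReal.zero_rpow h0.ne').le
    (fun x y => NNReal.rpow_add_le_add_rpow x y h0.le h1) s f

/-- As `1 / ρ ≤ 1`, the power passes inside the sum over messages by subadditivity. Averaging this
power of the Bhattacharyya union bound, instead of the bound itself, yields the expurgated exponent
for typical codes. -/
theorem sum_confusion_rpow_le {k n : ℕ} {ρ : ℝ} (hρ : 1 ≤ ρ) :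
    ∑ G : Matrix (Fin k) (Fin n) (ZMod 2), (W.confusion G).toReal ^ (1 / ρ) ≤
      Fintype.card (Matrix (Fin k) (Fin n) (ZMod 2)) *
        (2 ^ k * ((1 + W.bhattacharyya ^ (1 / ρ)) / 2) ^ n) := by
  have hρ0 : 0 < ρ := one_pos.trans_le hρ
  have ha : 0 < 1 / ρ := by positivity
  have ha1 : 1 / ρ ≤ 1 := (div_le_one hρ0).2 hρ
  have h1 : ∀ G : Matrix (Fin k) (Fin n) (ZMod 2), (W.confusion G).toReal ^ (1 / ρ) ≤
      ((∑ d : {d : Fin k → ZMod 2 // d ≠ 0}, ∏ t, W.bhat ((d.1 ᵥ* G) t) ^ (1 / ρ) : ℝ≥0) : ℝ) := by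
    intro G
    have h2 := ENNReal.toReal_mono ENNReal.coe_ne_top (W.confusion_le_sum G)
    rw [ENNReal.coe_toReal] at h2
    refine (Real.rpow_le_rpow ENNReal.toReal_nonneg h2 ha.le).trans ?_
    rw [← NNReal.coe_rpow, NNReal.coe_le_coe]
    refine (NNReal.rpow_sum_le_sum_rpow _ _ ha ha1).trans (le_of_eq ?_)
    simp_rw [NNReal.finsetProd_rpow]
  refine (Finset.sum_le_sum fun G _ => h1 G).trans ?_
  rw [← NNReal.coe_sum]
  have h3 := sum_ne_zero_prod_vecMul_le (k := k) fun (_ : Fin n) b => W.bhat b ^ (1 / ρ)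
  rw [Finset.prod_const, Finset.card_univ, Fintype.card_fin] at h3
  refine (NNReal.coe_le_coe.2 h3).trans (le_of_eq ?_)
  push_cast
  have e0 : W.bhat 0 = 1 := if_pos rfl
  have e1 : (W.bhat 1 : ℝ) = W.bhattacharyya := by
    have : W.bhat 1 = W.bhattacharyya.toNNReal := if_neg (by decide)
    rw [this, Real.coe_toNNReal _ W.bhattacharyya_nonneg]
  rw [e0, e1, NNReal.coe_one, Real.one_rpow, inv_mul_eq_div]

theorem sum_confusion_toReal_le {k n : ℕ} {ρ : ℝ} (hρ : ρ ∈ Icc (0 : ℝ) 1) :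
    ∑ G : Matrix (Fin k) (Fin n) (ZMod 2), (W.confusion G).toReal ≤
      Fintype.card (Matrix (Fin k) (Fin n) (ZMod 2)) * ((2 ^ k) ^ ρ * W.gallagerInt ρ ^ n) := by
  have h0 := W.gallagerInt_pos hρ.1
  rw [← ENNReal.toReal_sum fun G _ => ((W.confusion_le_one G).trans_lt ENNReal.one_lt_top).ne]
  exact ENNReal.toReal_le_of_le_ofReal (by positivity) (W.sum_confusion_le hρ)

end BMS

/-! ### Typical linear codes -/

namespace BMS

/-- The fraction of the generator matrices with confusion probability larger than `δ`. -/
def badFraction (W : BMS.{u}) (k n : ℕ) (δ : ℝ) : ℝ :=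
  (Nat.card {G : Matrix (Fin k) (Fin n) (ZMod 2) // δ < (W.confusion G).toReal} : ℝ) /
    Nat.card (Matrix (Fin k) (Fin n) (ZMod 2))

variable (W : BMS.{u})

theorem badFraction_nonneg (k n : ℕ) (δ : ℝ) : 0 ≤ W.badFraction k n δ := by
  unfold badFraction; positivity

/-- Markov's inequality. -/
theorem badFraction_le {k n : ℕ} {δ a B : ℝ} (hδ : 0 < δ) (ha : 0 < a)
    (h : ∑ G : Matrix (Fin k) (Fin n) (ZMod 2), (W.confusion G).toReal ^ a ≤
      Fintype.card (Matrix (Fin k) (Fin n) (ZMod 2)) * B) :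
    W.badFraction k n δ ≤ B / δ ^ a := by
  classical
  have hδa := Real.rpow_pos_of_pos hδ a
  have hC : (0 : ℝ) < Fintype.card (Matrix (Fin k) (Fin n) (ZMod 2)) := by
    exact_mod_cast Fintype.card_pos
  rw [badFraction, Nat.card_eq_fintype_card, Nat.card_eq_fintype_card, Fintype.card_subtype,
    div_le_div_iff₀ hC hδa, mul_comm B]
  refine le_trans ?_ h
  calc _ = ∑ G with δ < (W.confusion G).toReal, δ ^ a := by
        rw [Finset.sum_const, nsmul_eq_mul]
    _ ≤ ∑ G : Matrix (Fin k) (Fin n) (ZMod 2) with δ < (W.confusion G).toReal,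
          (W.confusion G).toReal ^ a :=
        Finset.sum_le_sum fun G hG =>
          Real.rpow_le_rpow hδ.le (Finset.mem_filter.1 hG).2.le ha.le
    _ ≤ _ := Finset.sum_le_sum_of_subset_of_nonneg (Finset.filter_subset _ _)
        fun G _ _ => Real.rpow_nonneg ENNReal.toReal_nonneg _

/-- Common to both exponents: `a = 1`, `b = ρ` for random coding and `a = 1 / ρ`, `b = 1` for the
expurgated bound. The `+ 1` from rounding up the dimension costs only a constant factor. -/
theorem tendsto_badFraction_of_sum_le {a b M c e R : ℝ} (ha : 0 < a) (hb : 0 ≤ b) (hM : 0 < M)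
    (hc : 0 < c) (H : ∀ k n, ∑ G : Matrix (Fin k) (Fin n) (ZMod 2), (W.confusion G).toReal ^ a ≤
      Fintype.card (Matrix (Fin k) (Fin n) (ZMod 2)) * ((2 ^ k) ^ b * M ^ n))
    (hlt : a * e + b * (R * Real.log 2) + Real.log M < 0) {k : ℕ → ℕ}
    (hk : ∀ n, (k n : ℝ) ≤ R * n + 1) :
    Tendsto (fun n : ℕ => W.badFraction (k n) n (c * Real.exp (-(n * e)))) atTop (𝓝 0) := by
  set κ := a * e + b * (R * Real.log 2) + Real.log M with hκ
  have hl : 0 < Real.log 2 := Real.log_pos (by norm_num)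
  have hlim : Tendsto (fun n : ℕ => Real.exp (b * Real.log 2) / c ^ a * Real.exp (n * κ)) atTop
      (𝓝 0) := by
    have h1 : Tendsto (fun n : ℕ => (n : ℝ) * κ) atTop atBot :=
      tendsto_natCast_atTop_atTop.atTop_mul_const_of_neg hlt
    simpa using (Real.tendsto_exp_atBot.comp h1).const_mul (Real.exp (b * Real.log 2) / c ^ a)
  refine squeeze_zero (fun n => W.badFraction_nonneg _ _ _) (fun n => ?_) hlim
  refine (W.badFraction_le (mul_pos hc (Real.exp_pos _)) ha (H (k n) n)).trans ?_
  have hca := Real.rpow_pos_of_pos hc a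
  have e1 : ((2 : ℝ) ^ k n) ^ b = Real.exp (k n * (b * Real.log 2)) := by
    rw [← Real.rpow_natCast, ← Real.rpow_mul (by norm_num), Real.rpow_def_of_pos (by norm_num)]
    ring_nf
  have e2 : M ^ n = Real.exp (n * Real.log M) := by
    rw [← Real.rpow_natCast, Real.rpow_def_of_pos hM, mul_comm]
  rw [Real.mul_rpow hc.le (Real.exp_pos _).le, ← Real.exp_mul, e1, e2, ← Real.exp_add,
    mul_comm (c ^ a), ← div_div, ← Real.exp_sub, div_mul_eq_mul_div, ← Real.exp_add]
  refine div_le_div_of_nonneg_right (Real.exp_le_exp.2 ?_) hca.le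
  have := mul_le_mul_of_nonneg_right (hk n) (mul_nonneg hb hl.le)
  rw [hκ]
  linarith

theorem badFraction_zero (n : ℕ) {δ : ℝ} (hδ : 0 ≤ δ) : W.badFraction 0 n δ = 0 := by
  have h : ∀ G : Matrix (Fin 0) (Fin n) (ZMod 2), W.confusion G = 0 := fun G => by
    have : {p : Fin n → ZMod 2 → ℝ≥0 | ∃ d ≠ 0, ∏ t, p t 0 ≤ ∏ t, p t ((d ᵥ* G) t)} = ∅ := by
      refine eq_empty_of_forall_notMem fun p ⟨d, hd, _⟩ => hd (Subsingleton.elim _ _)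
    rw [confusion, this, measure_empty]
  have : IsEmpty {G : Matrix (Fin 0) (Fin n) (ZMod 2) // δ < (W.confusion G).toReal} :=
    ⟨fun G => by
      have := G.2
      rw [h, ENNReal.toReal_zero] at this
      exact this.not_ge hδ⟩
  rw [badFraction, Nat.card_of_isEmpty]
  simp

/-- Typical linear codes achieve every exponent below `E(W, R)`. -/
theorem tendsto_badFraction {c e R : ℝ} (hc : 0 < c) (hR : 0 ≤ R) (he : (e : EReal) < W.E R) :
    Tendsto (fun n : ℕ => W.badFraction ⌈R * n⌉₊ n (c * Real.exp (-(n * e)))) atTop (𝓝 0) := by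
  -- At rate zero the code has one message and never errs, which matches the value `∞` of `E_r`.
  rcases hR.eq_or_lt with rfl | hR
  · simp only [zero_mul, Nat.ceil_zero]
    simp_rw [fun n : ℕ => W.badFraction_zero n (mul_pos hc (Real.exp_pos (-(n * e)))).le]
    exact tendsto_const_nhds
  have hk : ∀ n : ℕ, (⌈R * n⌉₊ : ℝ) ≤ R * n + 1 := fun n =>
    (Nat.ceil_lt_add_one (by positivity)).le
  rw [E, lt_max_iff] at he
  rcases he with he | he
  · rw [Er, if_neg hR.ne', lt_iSup_iff] at he
    obtain ⟨ρ, he⟩ := he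
    obtain ⟨hρ, he⟩ := lt_iSup_iff.1 he
    rw [EReal.coe_lt_coe_iff, gallagerE0_eq _ hρ.1] at he
    refine W.tendsto_badFraction_of_sum_le one_pos hρ.1 (W.gallagerInt_pos hρ.1) hc ?_ ?_ hk
    · intro k n
      simpa only [Real.rpow_one] using W.sum_confusion_toReal_le hρ
    · linarith
  · rw [Eex, lt_iSup_iff] at he
    obtain ⟨ρ, he⟩ := he
    obtain ⟨hρ, he⟩ := lt_iSup_iff.1 he
    rw [EReal.coe_lt_coe_iff, gallagerEx] at he
    have hρ0 : 0 < ρ := one_pos.trans_le hρ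
    have hz := Real.rpow_nonneg W.bhattacharyya_nonneg (1 / ρ)
    refine W.tendsto_badFraction_of_sum_le (a := 1 / ρ) (by positivity) zero_le_one
      (M := (1 + W.bhattacharyya ^ (1 / ρ)) / 2) (by positivity) hc ?_ ?_ hk
    · intro k n
      simpa only [Real.rpow_one] using W.sum_confusion_rpow_le hρ
    -- Multiplication by `ρ` turns the condition into `e < E_x(W, ρ) - ρ R ln 2`.
    · refine neg_of_mul_neg_right (a := ρ) ?_ hρ0.le
      have : ρ * (1 / ρ * e) = e := by field_simp
      rw [mul_add, mul_add, this]
      linarith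

end BMS

/-! ### The concatenated scheme with typical outer codes -/

theorem card_subtype_eval_div {ι : Type*} [Finite ι] {β : ι → Type*} [∀ i, Finite (β i)]
    [∀ i, Nonempty (β i)] (i : ι) (P : β i → Prop) :
    (Nat.card {f : ∀ i, β i // P (f i)} : ℝ) / Nat.card (∀ i, β i) =
      (Nat.card {x : β i // P x} : ℝ) / Nat.card (β i) := by
  classical
  have h1 : Nat.card (∀ i, β i) = Nat.card (β i) * Nat.card (∀ j : {j // j ≠ i}, β j) := by
    rw [Nat.card_congr (Equiv.piSplitAt i β), Nat.card_prod]
  have h2 : Nat.card {f : ∀ i, β i // P (f i)} =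
      Nat.card {x : β i // P x} * Nat.card (∀ j : {j // j ≠ i}, β j) := by
    rw [← Nat.card_prod]
    refine Nat.card_congr (((Equiv.piSplitAt i β).subtypeEquiv fun f => ?_).trans
      (Equiv.prodSubtypeFstEquivSubtypeProd (p := P)))
    rfl
  have h3 : (Nat.card (∀ j : {j // j ≠ i}, β j) : ℝ) ≠ 0 := by exact_mod_cast Nat.card_pos.ne'
  rw [h1, h2]
  push_cast
  rw [mul_div_mul_right _ _ h3]

namespace BMS

variable (W : BMS.{u})

/-- If each of the `2 ^ l` confusion probabilities is at most `δ / 2 ^ l`, the total error is at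
most `δ`; the exceptional families are counted by marginals. -/
theorem one_sub_sum_badFraction_le (l n : ℕ) (k : SubIdx l → ℕ) (δ : ℝ) :
    1 - ∑ s, (sub l W s).badFraction (k s) n ((2 ^ l)⁻¹ * δ) ≤ probErrorLe W l n k δ := by
  classical
  have hC : (0 : ℝ) < Nat.card (OuterCodes l n k) := by exact_mod_cast Nat.card_pos
  have h1 : ∀ s, (sub l W s).badFraction (k s) n ((2 ^ l)⁻¹ * δ) =
      (Nat.card {G : OuterCodes l n k // (2 ^ l)⁻¹ * δ < ((sub l W s).confusion (G s)).toReal} : ℝ)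
        / Nat.card (OuterCodes l n k) := fun s =>
    (card_subtype_eval_div (β := fun s => Matrix (Fin (k s)) (Fin n) (ZMod 2)) s
      fun G => (2 ^ l)⁻¹ * δ < ((sub l W s).confusion G).toReal).symm
  simp_rw [h1]
  rw [← Finset.sum_div, probErrorLe, ← div_self hC.ne', ← sub_div]
  refine div_le_div_of_nonneg_right ?_ hC.le
  rw [sub_le_iff_le_add]
  simp_rw [Nat.card_eq_fintype_card, Fintype.card_subtype]
  rw [← Finset.card_univ]
  have hcover : (Finset.univ : Finset (OuterCodes l n k)) ⊆
      Finset.univ.filter (fun G => errorProb W G ≤ δ) ∪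
      Finset.univ.biUnion fun s => Finset.univ.filter
        fun G : OuterCodes l n k => (2 ^ l)⁻¹ * δ < ((sub l W s).confusion (G s)).toReal := by
    intro G _
    by_cases hG : ∃ s, (2 ^ l)⁻¹ * δ < ((sub l W s).confusion (G s)).toReal
    · obtain ⟨s, hs⟩ := hG
      exact Finset.mem_union_right _ (Finset.mem_biUnion.2 ⟨s, Finset.mem_univ _, by simpa using hs⟩)
    · push Not at hG
      refine Finset.mem_union_left _ (Finset.mem_filter.2 ⟨Finset.mem_univ _, ?_⟩)
      refine (errorProb_le W G).trans ((Finset.sum_le_sum fun s _ => hG s).trans (le_of_eq ?_))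
      rw [Finset.sum_const, Finset.card_univ, card_subIdx, nsmul_eq_mul]
      push_cast
      rw [mul_inv_cancel_left₀ (by positivity)]
  have h2 := (Finset.card_le_card hcover).trans ((Finset.card_union_le _ _).trans
    (Nat.add_le_add_left Finset.card_biUnion_le _))
  exact_mod_cast h2

theorem probErrorLe_le_one (l n : ℕ) (k : SubIdx l → ℕ) (δ : ℝ) : probErrorLe W l n k δ ≤ 1 := by
  refine div_le_one_of_le₀ ?_ (by positivity)
  exact_mod_cast Nat.card_le_card_of_injective _ Subtype.val_injective

/-- Each step doubles the exponent required of the two halves, which accounts for the total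
blocklength `2 ^ l * n` against the outer blocklength `n`. Strictness of the inequality selects `R₁`
without the supremum being attained, and `rateInterval` keeps both rates in `[0, 1]`. -/
theorem exists_rates {l : ℕ} {R e : ℝ} (hR : R ∈ Icc (0 : ℝ) 1)
    (he : (e : EReal) < W.polarExponent l R) :
    ∃ r : SubIdx l → ℝ, (∀ s, r s ∈ Icc (0 : ℝ) 1) ∧ ∑ s, r s = 2 ^ l * R ∧
      ∀ s, ((2 ^ l * e : ℝ) : EReal) < (sub l W s).E (r s) := by
  induction l generalizing W R e with
  | zero =>
    refine ⟨fun _ => R, fun _ => hR, ?_, fun _ => ?_⟩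
    · rw [Finset.sum_const, Finset.card_univ, card_subIdx]; simp
    · rw [pow_zero, one_mul]; exact he
  | succ l ih =>
    have h2 : ((2 * e : ℝ) : EReal) < ⨆ R₁ ∈ rateInterval R,
        min (polarExponent l W.minus R₁) (polarExponent l W.plus (2 * R - R₁)) := by
      by_contra! hc
      rw [polarExponent] at he
      refine he.not_ge ((mul_le_mul_of_nonneg_left hc (by simp)).trans ?_)
      rw [← EReal.coe_mul, EReal.coe_le_coe_iff]
      linarith
    obtain ⟨R₁, h2⟩ := lt_iSup_iff.1 h2
    obtain ⟨hR₁, h2⟩ := lt_iSup_iff.1 h2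
    obtain ⟨h3, h4⟩ := lt_min_iff.1 h2
    obtain ⟨⟨ha, hb⟩, hc, hd⟩ := And.intro (max_le_iff.1 hR₁.1) (le_min_iff.1 hR₁.2)
    obtain ⟨r₁, h5, h6, h7⟩ := ih W.minus ⟨ha, hc⟩ h3
    obtain ⟨r₂, h8, h9, h10⟩ := ih W.plus (R := 2 * R - R₁) ⟨by linarith, by linarith⟩ h4
    have e1 : (2 : ℝ) ^ (l + 1) * e = 2 ^ l * (2 * e) := by ring
    rw [e1]
    refine ⟨fun s => Sum.elim r₁ r₂ s, ?_, ?_, ?_⟩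
    · rintro (s | s)
      · exact h5 s
      · exact h8 s
    · refine (Fintype.sum_sum_type fun s : SubIdx l ⊕ SubIdx l => Sum.elim r₁ r₂ s).trans ?_
      simp only [Sum.elim_inl, Sum.elim_inr]
      rw [h6, h9]
      ring
    · rintro (s | s)
      · exact h7 s
      · exact h10 s

theorem isAchievableExponent_of_lt {l : ℕ} {R e : ℝ} (hR : R ∈ Icc (0 : ℝ) 1)
    (he : (e : EReal) < W.polarExponent l R) : IsAchievableExponent W l R e := by
  obtain ⟨r, hr, hsum, hlt⟩ := W.exists_rates hR he
  refine ⟨fun n s => ⌈r s * n⌉₊, fun n s => ?_, fun n => ?_, ?_⟩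
  · refine Nat.ceil_le.2 (mul_le_of_le_one_left (by positivity) (hr s).2)
  · rw [← mul_assoc, mul_comm R, ← hsum, Finset.sum_mul]
    exact Finset.sum_le_sum fun s _ => Nat.le_ceil _
  · have hlim : Tendsto (fun n : ℕ => 1 - ∑ s, (sub l W s).badFraction ⌈r s * n⌉₊ n
        ((2 ^ l)⁻¹ * Real.exp (-(2 ^ l * n) * e))) atTop (𝓝 1) := by
      have h0 := tendsto_finsetSum Finset.univ fun s _ =>
        (sub l W s).tendsto_badFraction (c := (2 ^ l)⁻¹) (by positivity) (hr s).1 (hlt s)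
      have h1 := h0.const_sub 1
      rw [Finset.sum_const_zero, sub_zero] at h1
      refine h1.congr fun n => ?_
      congr 1
      refine Finset.sum_congr rfl fun s _ => ?_
      congr 3
      ring
    exact tendsto_of_tendsto_of_tendsto_of_le_of_le hlim tendsto_const_nhds
      (fun n => W.one_sub_sum_badFraction_le l n _ _) (fun n => W.probErrorLe_le_one l n _ _)

/-- Approximation by reals from strictly below also covers the value `⊤`. -/
theorem polarExponent_le_bestExponent {l : ℕ} {R : ℝ} (hR : R ∈ Icc (0 : ℝ) 1) :
    W.polarExponent l R ≤ bestExponent W l R :=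
  EReal.ge_of_forall_gt_iff_ge.1 fun _ he =>
    le_iSup₂_of_le _ (W.isAchievableExponent_of_lt hR he) le_rfl

end BMS

end

theorem theorem1 (W : BMS.{u}) (R : ℝ) (hR₀ : 0 ≤ R) (hR₁ : R ≤ 1) (l : ℕ) :
    capacityExponent l W.capacity R ≤ W.polarExponent l R ∧
      W.polarExponent l R ≤ bestExponent W l R :=
  ⟨W.capacityExponent_le_polarExponent l R, W.polarExponent_le_bestExponent ⟨hR₀, hR₁⟩⟩
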